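/- **Setting.** Let $G=(A\cup B,\mathcal E)$ be a finite bipartite graph in which every vertex of $A$ has degree $d_A$ and every vertex of $B$ has degree $d_B$, where $1\le d_A\le d_B$. For $\gamma,\delta>0$, the graph $G$ is $(\gamma,\delta)$-expanding if every $S\subseteq A$ with $|S|\le\gamma|A|$ satisfies $|\Gamma(S)|\ge(1-\delta)d_A|S|$ and every $S\subseteq B$ with $|S|\le\gamma|B|$ satisfies $|\Gamma(S)|\ge(1-\delta)d_B|S|$. The quantum expander code of $G$ has the qubits $V=A^2\uplus B^2$, $n=|V|$, the $Z$-type generators $C_X=A\times B$ and the $X$-type generators $C_Z=B\times A$. A qubit $(\alpha,a)\in A^2$ is adjacent to $(\alpha,\beta')\in C_X$ for $\beta'\in\Gamma(a)$ and to $(b,a)\in C_Z$ for $b\in\Gamma(\alpha)$; a qubit $(b,\beta')\in B^2$ is adjacent to $(\alpha,\beta')\in C_X$ for $\alpha\in\Gamma(b)$ and to $(b,a)\in C_Z$ for $a\in\Gamma(\beta')$. Write $\Gamma_X(v)\subseteq C_X$ for the set of $Z$-type generators adjacent to the qubit $v$ and $\Gamma_Z(g)\subseteq V$ for the set of qubits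 adjacent to $g\in C_Z$. With $\oplus$ the symmetric difference, the syndrome of $E\subseteq V$ is $\sigma_X(E)=\bigoplus_{v\in E}\Gamma_X(v)\subseteq C_X$, and $E,E'\subseteq V$ are equivalent if $E\oplus E'=\bigoplus_{g\in X}\Gamma_Z(g)$ for some $X\subseteq C_Z$. The sequential small-set-flip decoder of parameter $\beta$ takes an input $\sigma\subseteq C_X$ and starts with $\hat E_0=\varnothing$, $\sigma_0=\sigma$. As long as there is a nonempty $F$, contained in $\Gamma_Z(g)$ for some $g\in C_Z$, with $|\sigma_X(F)|\ge\frac{d_A}{2}|F|$ and $|\sigma_i|-|\sigma_i\oplus\sigma_X(F)|\ge\beta\,|\sigma_X(F)|$, it picks an arbitrary such $F=F_i$ and sets $\hat E_{i+1}=\hat E_i\oplus F_i$, $\sigma_{i+1}=\sigma_i\oplus\sigma_X(F_i)$; when there is none, it returns $\hat E=\hat E_i$. A random pair $(E,D)$ with $E\subseteq V$, $D\subseteq C_X$ is local stochastic with parameters $(p,q)$ if $\mathbb P[S\subseteq E,\,T\subseteq D]\le p^{|S|}q^{|T|}$ for all $S\subseteq V$, $T\subseteq C_X$; a random $E\subseteq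 V$ is local stochastic with parameter $p$ if $\mathbb P[S\subseteq E]\le p^{|S|}$ for all $S\subseteq V$. **Theorem.** Let $1\le d_A\le d_B$ be integers, $\gamma>0$, $0<\delta<\frac1{16}$, $\beta_1=1-16\delta$, $0<\beta<\beta_1$ and $c_0=\frac{4}{d_A(\beta_1-\beta)}$. There are constants $p_0,p_1,K,\kappa>0$, depending only on $d_A,d_B,\gamma,\delta,\beta$, such that the following holds for every $(d_A,d_B)$-biregular $(\gamma,\delta)$-expanding bipartite graph $G$ and all $0\le p_{\mathrm{phys}}<p_0$, $0\le p_{\mathrm{synd}}<p_1$. Let $(E,D)$ be a random pair, $E\subseteq V$, $D\subseteq C_X$, that is local stochastic with parameters $(p_{\mathrm{phys}},p_{\mathrm{synd}})$, and let $\hat E$ be a random set that is always an output of the small-set-flip decoder of parameter $\beta$ on the input $\sigma_X(E)\oplus D$ (with any choice of the flips $F_i$). Then there exist an event $\mathsf{succ}$ with $$\mathbb P[\mathsf{succ}]\ \ge\ 1-e^{-\kappa\sqrt n}$$ and a random set $E_{\mathrm{ls}}\subseteq V$, always equivalent to $E\oplus\hat E$, such that, conditioned on $\mathsf{succ}$,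 $E_{\mathrm{ls}}$ is local stochastic with parameter $K\,p_{\mathrm{synd}}^{1/c_0}$: $$\mathbb P[S\subseteq E_{\mathrm{ls}}\mid\mathsf{succ}]\ \le\ \bigl(K\,p_{\mathrm{synd}}^{1/c_0}\bigr)^{|S|}\qquad\text{for all }S\subseteq V.$$ -/

import Mathlib

open scoped symmDiff

/-! ### Biregular bipartite expanders

A bipartite graph with left part `A` and right part `B` is given by its adjacency relation
`G : A → B → Prop`. -/

section Graph

variable {A B : Type*} [Fintype A] [Fintype B] [DecidableEq A] [DecidableEq B]

/-- The neighbourhood `Γ(a) ⊆ B` of a left vertex `a`. -/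
def nbrLeft (G : A → B → Prop) [DecidableRel G] (a : A) : Finset B :=
  Finset.univ.filter (fun b => G a b)

/-- The neighbourhood `Γ(b) ⊆ A` of a right vertex `b`. -/
def nbrRight (G : A → B → Prop) [DecidableRel G] (b : B) : Finset A :=
  Finset.univ.filter (fun a => G a b)

/-- All left vertices have degree `dA` and all right vertices have degree `dB`. -/
def IsBiregular (G : A → B → Prop) [DecidableRel G] (dA dB : ℕ) : Prop :=
  (∀ a, (nbrLeft G a).card = dA) ∧ (∀ b, (nbrRight G b).card = dB)

/-- A graph with degrees `dA`, `dB` is `(γ, δ)`-expanding if every `S ⊆ A` with `|S| ≤ γ |A|` has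
at least `(1 - δ) dA |S|` neighbours, and every `S ⊆ B` with `|S| ≤ γ |B|` has at least
`(1 - δ) dB |S|` neighbours. -/
def IsExpanding (G : A → B → Prop) [DecidableRel G] (dA dB : ℕ) (γ δ : ℝ) : Prop :=
  (∀ S : Finset A, (S.card : ℝ) ≤ γ * Fintype.card A →
    (1 - δ) * dA * S.card ≤ ((S.biUnion (nbrLeft G)).card : ℝ)) ∧
  (∀ S : Finset B, (S.card : ℝ) ≤ γ * Fintype.card B →
    (1 - δ) * dB * S.card ≤ ((S.biUnion (nbrRight G)).card : ℝ))

end Graph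

/-! ### The iterated symmetric difference of finite sets -/

section XorSum

variable {ι α : Type*} [Fintype α] [DecidableEq α]

/-- `⊕_{i ∈ s} f i`: the elements that lie in an odd number of the sets `f i`, `i ∈ s`. -/
def xorSum (s : Finset ι) (f : ι → Finset α) : Finset α :=
  Finset.univ.filter (fun x => Odd (s.filter (fun i => x ∈ f i)).card)

theorem xorSum_empty (f : ι → Finset α) : xorSum ∅ f = ∅ := by
  ext x; simp [xorSum]

theorem xorSum_insert [DecidableEq ι] {s : Finset ι} {i : ι} (hi : i ∉ s) (f : ι → Finset α) :
    xorSum (insert i s) f = f i ∆ xorSum s f := by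
  ext x
  simp only [xorSum, Finset.mem_filter, Finset.mem_univ, true_and, Finset.mem_symmDiff,
    Finset.filter_insert]
  by_cases h : x ∈ f i
  · simp [h, hi, Nat.odd_add_one]
  · simp [h]

end XorSum

/-! ### The quantum expander code of `G` (hypergraph product of the code of `G` with itself) -/

section Code

/-- The set of qubits `V = A² ⊎ B²`. -/
abbrev Qubit (A B : Type*) : Type _ := (A × A) ⊕ (B × B)

variable {A B : Type*} [Fintype A] [Fintype B] [DecidableEq A] [DecidableEq B]

/-- `Γ_X(v) ⊆ C_X = A × B`: the `Z`-type generators acting on the qubit `v`. The qubit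
`(α, a) ∈ A²` is adjacent to `(α, β)` for `β ∈ Γ(a)`; the qubit `(b, β) ∈ B²` is adjacent to
`(α, β)` for `α ∈ Γ(b)`. -/
def gammaX (G : A → B → Prop) [DecidableRel G] : Qubit A B → Finset (A × B)
  | Sum.inl (α, a) => {α} ×ˢ nbrLeft G a
  | Sum.inr (b, β) => nbrRight G b ×ˢ {β}

/-- `Γ_Z(g) ⊆ V`: the support of the `X`-type generator `g ∈ C_Z = B × A`. The generator `(b, a)`
acts on the qubits `(α, a) ∈ A²` with `α ∈ Γ(b)` and `(b, β) ∈ B²` with `β ∈ Γ(a)`. -/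
def gammaZ (G : A → B → Prop) [DecidableRel G] (g : B × A) : Finset (Qubit A B) :=
  (nbrRight G g.1 ×ˢ {g.2}).disjSum ({g.1} ×ˢ nbrLeft G g.2)

/-- The syndrome `σ_X(E) = ⊕_{v ∈ E} Γ_X(v)` of an `X`-type error `E ⊆ V`. -/
def syndromeX (G : A → B → Prop) [DecidableRel G] (E : Finset (Qubit A B)) : Finset (A × B) :=
  xorSum E (gammaX G)

/-- Two `X`-type errors are equivalent if they differ by a sum of `X`-type generators, that is,
by an element of `𝒞_Z^⊥`. -/
def EquivErrors (G : A → B → Prop) [DecidableRel G] (E E' : Finset (Qubit A B)) : Prop :=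
  ∃ X : Finset (B × A), E ∆ E' = xorSum X (gammaZ G)

end Code

/-! ### The small-set-flip decoder -/

section Decoder

variable {A B : Type*} [Fintype A] [Fintype B] [DecidableEq A] [DecidableEq B]

/-- `F` is a nonempty element of
`ℱ = {F ⊆ Γ_Z(g) : g ∈ C_Z and |σ_X(F)| ≥ (dA / 2) |F|}`. The empty set is left out: flipping it
changes nothing and would always satisfy the condition of the while loop. -/
def IsFlip (G : A → B → Prop) [DecidableRel G] (dA : ℕ) (F : Finset (Qubit A B)) : Prop :=
  F.Nonempty ∧ (∃ g : B × A, F ⊆ gammaZ G g) ∧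
    (dA : ℝ) / 2 * F.card ≤ ((syndromeX G F).card : ℝ)

/-- `Δ(σ, F) = |σ| - |σ ⊕ σ_X(F)|`. -/
def syndromeDecrease (G : A → B → Prop) [DecidableRel G] (σ : Finset (A × B))
    (F : Finset (Qubit A B)) : ℤ :=
  (σ.card : ℤ) - ((σ ∆ syndromeX G F).card : ℤ)

/-- `F` may be flipped when the current syndrome is `σ`: `F ∈ ℱ` and
`Δ(σ, F) ≥ β |σ_X(F)|`. -/
def CanFlip (G : A → B → Prop) [DecidableRel G] (dA : ℕ) (β : ℝ) (σ : Finset (A × B))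
    (F : Finset (Qubit A B)) : Prop :=
  IsFlip G dA F ∧ β * ((syndromeX G F).card : ℝ) ≤ (syndromeDecrease G σ F : ℝ)

/-- One pass of the while loop, on states `(Ê_i, σ_i)`: an arbitrary admissible `F_i` is flipped. -/
def DecoderStep (G : A → B → Prop) [DecidableRel G] (dA : ℕ) (β : ℝ)
    (s t : Finset (Qubit A B) × Finset (A × B)) : Prop :=
  ∃ F, CanFlip G dA β s.2 F ∧ t = (s.1 ∆ F, s.2 ∆ syndromeX G F)

/-- `Ehat` is the output of some valid execution of the small-set-flip decoder of parameter `β` on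
the input syndrome `σ`: starting from `(∅, σ)`, a finite number of passes leads to a state whose
first component is `Ehat` and in which the condition of the while loop fails. -/
def IsDecoderOutput (G : A → B → Prop) [DecidableRel G] (dA : ℕ) (β : ℝ) (σ : Finset (A × B))
    (Ehat : Finset (Qubit A B)) : Prop :=
  ∃ σf : Finset (A × B),
    Relation.ReflTransGen (DecoderStep G dA β) (∅, σ) (Ehat, σf) ∧
      ¬ ∃ F, CanFlip G dA β σf F

/-- The decoder always terminates, so every input syndrome has an output. -/
theorem exists_isDecoderOutput (G : A → B → Prop) [DecidableRel G] {dA : ℕ} {β : ℝ}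
    (hdA : 0 < dA) (hβ : 0 < β) (σ : Finset (A × B)) :
    ∃ Ehat, IsDecoderOutput G dA β σ Ehat := by
  suffices h : ∀ (k : ℕ) (s : Finset (Qubit A B) × Finset (A × B)), s.2.card = k →
      ∃ t, Relation.ReflTransGen (DecoderStep G dA β) s t ∧ ¬ ∃ F, CanFlip G dA β t.2 F by
    obtain ⟨t, ht, hF⟩ := h _ (∅, σ) rfl
    exact ⟨t.1, t.2, ht, hF⟩
  intro k
  induction k using Nat.strong_induction_on with
  | _ k ih =>
    intro s hs
    by_cases hF : ∃ F, CanFlip G dA β s.2 F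
    · obtain ⟨F, hF⟩ := hF
      have h0 : (0 : ℝ) < F.card := by exact_mod_cast hF.1.1.card_pos
      have h1 : (0 : ℝ) < dA := by exact_mod_cast hdA
      have h2 : (0 : ℝ) < ((syndromeX G F).card : ℝ) :=
        lt_of_lt_of_le (by positivity) hF.1.2.2
      have h3 : (0 : ℝ) < (syndromeDecrease G s.2 F : ℝ) :=
        lt_of_lt_of_le (mul_pos hβ h2) hF.2
      have h4 : 0 < syndromeDecrease G s.2 F := by exact_mod_cast h3
      have h5 : (s.2 ∆ syndromeX G F).card < k := by
        unfold syndromeDecrease at h4; omega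
      obtain ⟨t, ht, hn⟩ := ih _ h5 (s.1 ∆ F, s.2 ∆ syndromeX G F) rfl
      exact ⟨t, Relation.ReflTransGen.head ⟨F, hF, rfl⟩ ht, hn⟩
    · exact ⟨s, Relation.ReflTransGen.refl, hF⟩

end Decoder

/-! ### Noise -/

section Noise

open MeasureTheory

variable {Ω V C : Type*} [MeasurableSpace Ω]

/-- `X` is a random (finite) set: a random variable for the discrete σ-algebra. -/
def IsRandomSet (X : Ω → Finset V) : Prop :=
  ∀ S : Finset V, MeasurableSet {ω | X ω = S}

/-- Local stochastic noise with parameters `(p, q)` for a pair of random sets: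
`ℙ[S ⊆ E, T ⊆ D] ≤ p ^ |S| q ^ |T|` for all `S` and `T`. -/
def IsLocalStochasticPair (μ : Measure Ω) (E : Ω → Finset V) (D : Ω → Finset C)
    (p q : ℝ) : Prop :=
  ∀ (S : Finset V) (T : Finset C),
    μ.real {ω | S ⊆ E ω ∧ T ⊆ D ω} ≤ p ^ S.card * q ^ T.card

/-- Local stochastic noise with parameter `p` for one random set:
`ℙ[S ⊆ E] ≤ p ^ |S|` for all `S`. -/
def IsLocalStochastic (μ : Measure Ω) (E : Ω → Finset V) (p : ℝ) : Prop :=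
  ∀ S : Finset V, μ.real {ω | S ⊆ E ω} ≤ p ^ S.card

end Noise

/-! ### Constants -/

/-- `β₁ = 1 - 16 δ`. -/
noncomputable def betaOne (δ : ℝ) : ℝ := 1 - 16 * δ

/-- `c₀ = 4 / (dA (β₁ - β))`. -/
noncomputable def cZero (dA : ℕ) (δ β : ℝ) : ℝ := 4 / (dA * (betaOne δ - β))

/-! The proof combines percolation with expansion. Call two qubits adjacent when some generator of
either type acts on both; this graph has bounded degree. Adjacency through `Z`-type generators
(checks) makes syndromes split along components. Adjacency through `X`-type generators keeps each
flip inside one component. All accounting is therefore done component by component.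

Let `U` collect `E` and all the flips made. A flip lowers the syndrome by an amount proportional to
its size, so a potential argument bounds each component of `U` by a constant times the number of
qubit and syndrome errors it meets (`DecoderStep.exists_region`). This survives, with a larger
constant, when generators are added to the residual error until no single one lowers a suitable
weight (`exists_reducedError`). Counting connected sets against the local stochastic bound shows
that such heavy connected sets all have at most `γ |B|` qubits, a quantity of order `√n`, outside an
event of probability `e^(-κ√n)` (`measureReal_exists_heavy_le`). This defines `succ`.

On `succ` the components of the reduced residual error `R` are small enough for expansion, and any
union `W` of them can be peeled into flips whose syndromes hardly overlap (`exists_peeling`). The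
decoder has stopped, so none of these flips is profitable for the observed syndrome `σ_X(R) ⊕ D`.
Hence `D` must hide a fixed share of `σ_X(W)`, which gives `|W| ≤ c₀ |D ∩ Γ(W)|`
(`card_le_of_not_canFlip`). If `S ⊆ R`, let `W` consist of the components of `R` meeting `S`. A
union bound over `W` (`sum_rooted_pow_le`, `measureReal_exists_paid_le`) gives the required decay in
`|S|`, with `E_ls = R`. -/

set_option linter.unusedSectionVars false

/-! ### Counting sets all of whose components meet a given set -/

section Rooted

variable {V : Type*}

/-- `K ⊆ U` is a union of connected components of `U` for the (symmetric) relation `H`. -/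
def IsSeparated (H : V → V → Prop) (U K : Finset V) : Prop :=
  K ⊆ U ∧ ∀ x ∈ K, ∀ y ∈ U, H x y → y ∈ K

/-- `S ⊆ W` and every connected component of `W` meets `S`. -/
def Rooted (H : V → V → Prop) (S W : Finset V) : Prop :=
  S ⊆ W ∧ ∀ T, S ⊆ T → IsSeparated H W T → T = W

/-- The intersection of all separated subsets of `U` containing `S` works; it is the union of the
components of `U` meeting `S`. -/
theorem exists_rooted_isSeparated (H : V → V → Prop) {U S : Finset V} (hS : S ⊆ U) :
    ∃ W, Rooted H S W ∧ IsSeparated H U W := by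
  classical
  let W := U.filter (fun x => ∀ T, S ⊆ T → IsSeparated H U T → x ∈ T)
  have hW : IsSeparated H U W := by
    refine ⟨Finset.filter_subset _ _, fun x hx y hy hxy => ?_⟩
    rw [Finset.mem_filter] at hx ⊢
    exact ⟨hy, fun T hST hT => hT.2 x (hx.2 T hST hT) y hy hxy⟩
  refine ⟨W, ⟨fun x hx => Finset.mem_filter.2 ⟨hS hx, fun T hST _ => hST hx⟩, ?_⟩, hW⟩
  intro T hST hT
  refine Finset.Subset.antisymm hT.1 fun x hx => ?_
  refine (Finset.mem_filter.1 hx).2 T hST ⟨hT.1.trans hW.1, fun x hx y hy hxy => ?_⟩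
  exact hT.2 x hx y (hW.2 x (hT.1 hx) y hy hxy) hxy

/-- Removing `v` may split a component, but each piece contains an old root or a neighbour of `v`;
these neighbours become roots. -/
theorem Rooted.erase [DecidableEq V] {H : V → V → Prop} [DecidableRel H] {S W : Finset V} {v : V}
    (h : Rooted H S W) (hv : v ∈ S) :
    Rooted H (S.erase v ∪ (W.erase v).filter (H v)) (W.erase v) := by
  refine ⟨Finset.union_subset (Finset.erase_subset_erase v h.1) (Finset.filter_subset _ _), ?_⟩
  intro T hST hT
  have hvT : v ∉ T := fun hvT => by simpa using hT.1 hvT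
  have key : insert v T = W := by
    refine h.2 _ (fun x hx => ?_) ⟨?_, ?_⟩
    · by_cases hxv : x = v
      · simp [hxv]
      · exact Finset.mem_insert_of_mem (hST (Finset.mem_union_left _
          (Finset.mem_erase.2 ⟨hxv, hx⟩)))
    · exact Finset.insert_subset (h.1 hv) (hT.1.trans (Finset.erase_subset _ _))
    · intro x hx y hy hxy
      by_cases hyv : y = v
      · simp [hyv]
      refine Finset.mem_insert_of_mem ?_
      have hy' : y ∈ W.erase v := Finset.mem_erase.2 ⟨hyv, hy⟩
      rcases Finset.mem_insert.1 hx with rfl | hx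
      · exact hST (Finset.mem_union_right _ (Finset.mem_filter.2 ⟨hy', hxy⟩))
      · exact hT.2 x hx y hy' hxy
  rw [← key, Finset.erase_insert hvT]

-- Explore from a root `v`: once the set `M` of neighbours of `v` in `W` is fixed, `W \ {v}` is
-- rooted at the other roots together with `M`, inside a smaller `Y`. There are at most `2 ^ k`
-- choices of `M`, and the factor `2⁻¹ ^ k` of `v` cancels them.
open Classical in
theorem sum_rooted_subset_le [Fintype V] [DecidableEq V] {H : V → V → Prop} {k : ℕ}
    (hk : ∀ v, (Finset.univ.filter (H v)).card ≤ k) (Y : Finset V) :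
    ∀ S : Finset V, ∑ W ∈ Y.powerset.filter (Rooted H S), ((2 : ℝ)⁻¹ ^ k) ^ W.card ≤ 1 := by
  induction Y using Finset.strongInduction with
  | H Y ih =>
  intro S
  rcases S.eq_empty_or_nonempty with rfl | ⟨v, hv⟩
  · have hsub : Y.powerset.filter (Rooted H ∅) ⊆ {∅} := by
      intro W hW
      have := (Finset.mem_filter.1 hW).2.2 ∅ (by simp) ⟨by simp, by simp⟩
      simp [← this]
    refine (Finset.sum_le_sum_of_subset_of_nonneg hsub (fun _ _ _ => by positivity)).trans ?_
    simp
  by_cases hvY : v ∈ Y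
  swap
  · rw [Finset.filter_false_of_mem]
    · simp
    · intro W hW h
      exact hvY (Finset.mem_powerset.1 hW (h.1 hv))
  set z : ℝ := (2 : ℝ)⁻¹ ^ k with hz
  have hz0 : 0 ≤ z := by positivity
  let N : Finset V → Finset V := fun W => (W.erase v).filter (H v)
  have hmaps : ∀ W ∈ Y.powerset.filter (Rooted H S),
      N W ∈ (Finset.univ.filter (H v)).powerset := by
    intro W _
    rw [Finset.mem_powerset]
    intro x hx
    simpa using (Finset.mem_filter.1 hx).2
  rw [← Finset.sum_fiberwise_of_maps_to hmaps]
  have hfib : ∀ M ∈ (Finset.univ.filter (H v)).powerset,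
      ∑ W ∈ (Y.powerset.filter (Rooted H S)).filter (fun W => N W = M), z ^ W.card ≤ z := by
    intro M _
    have h1 : ∑ W ∈ (Y.powerset.filter (Rooted H S)).filter (fun W => N W = M), z ^ W.card
        = z * ∑ W ∈ (Y.powerset.filter (Rooted H S)).filter (fun W => N W = M),
          z ^ (W.erase v).card := by
      rw [Finset.mul_sum]
      refine Finset.sum_congr rfl fun W hW => ?_
      have hvW : v ∈ W := (Finset.mem_filter.1 (Finset.mem_filter.1 hW).1).2.1 hv
      rw [← Finset.card_erase_add_one hvW, pow_succ']
    have h2 : ∑ W ∈ (Y.powerset.filter (Rooted H S)).filter (fun W => N W = M),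
          z ^ (W.erase v).card ≤
        ∑ W ∈ (Y.erase v).powerset.filter (Rooted H (S.erase v ∪ M)), z ^ W.card := by
      rw [← Finset.sum_image (f := fun W : Finset V => z ^ W.card)
        (g := fun W : Finset V => W.erase v)]
      · refine Finset.sum_le_sum_of_subset_of_nonneg ?_ (fun _ _ _ => by positivity)
        intro W' hW'
        obtain ⟨W, hW, rfl⟩ := Finset.mem_image.1 hW'
        obtain ⟨hW1, rfl⟩ := Finset.mem_filter.1 hW
        obtain ⟨hWY, hWS⟩ := Finset.mem_filter.1 hW1
        exact Finset.mem_filter.2 ⟨Finset.mem_powerset.2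
          (Finset.erase_subset_erase v (Finset.mem_powerset.1 hWY)), hWS.erase hv⟩
      · intro W hW W' hW' h
        have hvW : v ∈ W := (Finset.mem_filter.1 (Finset.mem_filter.1 hW).1).2.1 hv
        have hvW' : v ∈ W' := (Finset.mem_filter.1 (Finset.mem_filter.1 hW').1).2.1 hv
        rw [← Finset.insert_erase hvW, ← Finset.insert_erase hvW']
        exact congrArg (insert v) h
    rw [h1]
    calc _ ≤ z * 1 := mul_le_mul_of_nonneg_left
          (h2.trans (ih _ (Finset.erase_ssubset hvY) _)) hz0
      _ = z := mul_one z
  refine (Finset.sum_le_sum hfib).trans ?_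
  rw [Finset.sum_const, Finset.card_powerset, nsmul_eq_mul, hz]
  have : ((2 : ℝ) ^ (Finset.univ.filter (H v)).card) ≤ 2 ^ k :=
    pow_le_pow_right₀ (by norm_num) (hk v)
  calc _ ≤ (2 : ℝ) ^ k * 2⁻¹ ^ k := by push_cast; gcongr
    _ = 1 := by rw [← mul_pow]; norm_num

open Classical in
theorem sum_rooted_pow_le [Fintype V] [DecidableEq V] {H : V → V → Prop} {k : ℕ}
    (hk : ∀ v, (Finset.univ.filter (H v)).card ≤ k) (S : Finset V) {q : ℝ} (hq : 0 ≤ q)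
    (hqk : 2 ^ k * q ≤ 1) :
    ∑ W ∈ Finset.univ.filter (Rooted H S), q ^ W.card ≤ (2 ^ k * q) ^ S.card := by
  have h := sum_rooted_subset_le hk Finset.univ S
  rw [Finset.powerset_univ] at h
  calc ∑ W ∈ Finset.univ.filter (Rooted H S), q ^ W.card
      ≤ ∑ W ∈ Finset.univ.filter (Rooted H S),
        (2 ^ k * q) ^ S.card * ((2 : ℝ)⁻¹ ^ k) ^ W.card := by
        refine Finset.sum_le_sum fun W hW => ?_
        have hSW := Finset.card_le_card (Finset.mem_filter.1 hW).2.1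
        calc q ^ W.card = (2 ^ k * q) ^ W.card * ((2 : ℝ)⁻¹ ^ k) ^ W.card := by
              rw [← mul_pow, mul_right_comm, ← mul_pow]; norm_num
          _ ≤ _ := by
              gcongr ?_ * _
              exact pow_le_pow_of_le_one (by positivity) hqk hSW
    _ ≤ (2 ^ k * q) ^ S.card * 1 := by
        rw [← Finset.mul_sum]
        gcongr
    _ = _ := mul_one _

end Rooted

/-! ### Unique neighbours and algebra of symmetric differences -/

section Counting

variable {ι α : Type*}

/-- In a good expander some vertex of every small set has almost only unique neighbours. -/
theorem exists_card_shared_le [DecidableEq ι] [DecidableEq α] {S : Finset ι} (hS : S.Nonempty)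
    (f : ι → Finset α) {d : ℕ} {δ : ℝ} (hf : ∀ i ∈ S, (f i).card = d)
    (h : (1 - δ) * d * S.card ≤ ((S.biUnion f).card : ℝ)) :
    ∃ i ∈ S, (((f i).filter (fun x => ∃ j ∈ S, j ≠ i ∧ x ∈ f j)).card : ℝ) ≤ 2 * δ * d := by
  -- A neighbour of multiplicity `m` counts `2` on the left, plus `m` if `m ≥ 2`, against `2m` on
  -- the right. With expansion, the average number of shared neighbours is then at most `2δd`.
  have hcount : 2 * (S.biUnion f).card +
      ∑ i ∈ S, ((f i).filter (fun x => ∃ j ∈ S, j ≠ i ∧ x ∈ f j)).card ≤ 2 * ∑ i ∈ S, (f i).card := by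
    have e1 : ∑ i ∈ S, (f i).card = ∑ x ∈ S.biUnion f, (S.filter (fun i => x ∈ f i)).card := by
      refine Eq.trans ?_ (Finset.sum_card_bipartiteAbove_eq_sum_card_bipartiteBelow (s := S)
        (t := S.biUnion f) (fun i x => x ∈ f i))
      refine Finset.sum_congr rfl fun i hi => congrArg _ ?_
      ext x
      simp only [Finset.bipartiteAbove, Finset.mem_filter, Finset.mem_biUnion]
      exact ⟨fun hx => ⟨⟨i, hi, hx⟩, hx⟩, fun hx => hx.2⟩
    have e2 : ∑ i ∈ S, ((f i).filter (fun x => ∃ j ∈ S, j ≠ i ∧ x ∈ f j)).card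
        = ∑ x ∈ S.biUnion f,
          (S.filter (fun i => x ∈ f i ∧ ∃ j ∈ S, j ≠ i ∧ x ∈ f j)).card := by
      refine Eq.trans ?_ (Finset.sum_card_bipartiteAbove_eq_sum_card_bipartiteBelow (s := S)
        (t := S.biUnion f) (fun i x => x ∈ f i ∧ ∃ j ∈ S, j ≠ i ∧ x ∈ f j))
      refine Finset.sum_congr rfl fun i hi => congrArg _ ?_
      ext x
      simp only [Finset.bipartiteAbove, Finset.mem_filter, Finset.mem_biUnion]
      exact ⟨fun hx => ⟨⟨i, hi, hx.1⟩, hx⟩, fun hx => hx.2⟩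
    rw [e1, e2, Finset.card_eq_sum_ones, Finset.mul_sum, Finset.mul_sum, ← Finset.sum_add_distrib]
    refine Finset.sum_le_sum fun x hx => ?_
    obtain ⟨i, hi, hxi⟩ := Finset.mem_biUnion.1 hx
    have hpos : 0 < (S.filter (fun i => x ∈ f i)).card :=
      Finset.card_pos.2 ⟨i, Finset.mem_filter.2 ⟨hi, hxi⟩⟩
    have hle : (S.filter (fun i => x ∈ f i ∧ ∃ j ∈ S, j ≠ i ∧ x ∈ f j)).card ≤
        (S.filter (fun i => x ∈ f i)).card :=
      Finset.card_le_card fun i hi => by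
        simp only [Finset.mem_filter] at hi ⊢
        exact ⟨hi.1, hi.2.1⟩
    by_cases h1 : (S.filter (fun i => x ∈ f i)).card = 1
    · have h0 : S.filter (fun i => x ∈ f i ∧ ∃ j ∈ S, j ≠ i ∧ x ∈ f j) = ∅ := by
        refine Finset.filter_eq_empty_iff.2 fun i hi ⟨hxi, j, hj, hji, hxj⟩ => hji ?_
        exact Finset.card_le_one.1 h1.le j (Finset.mem_filter.2 ⟨hj, hxj⟩) i
          (Finset.mem_filter.2 ⟨hi, hxi⟩)
      rw [h0, h1]; simp
    · omega
  have hsum : ∑ i ∈ S, (f i).card = S.card * d := by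
    rw [Finset.sum_congr rfl hf, Finset.sum_const, smul_eq_mul]
  rw [hsum] at hcount
  have hcount' : 2 * ((S.biUnion f).card : ℝ) +
      ∑ i ∈ S, (((f i).filter (fun x => ∃ j ∈ S, j ≠ i ∧ x ∈ f j)).card : ℝ) ≤
        2 * (S.card * d) := by exact_mod_cast hcount
  refine Finset.exists_le_of_sum_le hS ?_
  rw [Finset.sum_const, nsmul_eq_mul]
  linarith

theorem Finset.card_symmDiff_add_two_mul [DecidableEq α] (s t : Finset α) :
    (s ∆ t).card + 2 * (s ∩ t).card = s.card + t.card := by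
  have h1 : (s ∆ t).card = (s \ t).card + (t \ s).card :=
    Finset.card_union_of_disjoint disjoint_sdiff_sdiff
  have h2 := Finset.card_sdiff_add_card_inter s t
  have h3 := Finset.card_sdiff_add_card_inter t s
  rw [Finset.inter_comm t s] at h3
  omega

theorem xorSum_symmDiff [Fintype α] [DecidableEq α] [DecidableEq ι] (s t : Finset ι)
    (f : ι → Finset α) : xorSum (s ∆ t) f = xorSum s f ∆ xorSum t f := by
  ext x
  have h : (s ∆ t).filter (fun i => x ∈ f i) =
      s.filter (fun i => x ∈ f i) ∆ t.filter (fun i => x ∈ f i) := by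
    ext i
    simp only [Finset.mem_filter, Finset.mem_symmDiff]
    tauto
  have h2 := Finset.card_symmDiff_add_two_mul (s.filter (fun i => x ∈ f i))
    (t.filter (fun i => x ∈ f i))
  simp only [xorSum, Finset.mem_filter, Finset.mem_univ, true_and, Finset.mem_symmDiff, h]
  simp only [Nat.odd_iff]
  omega

theorem xorSum_singleton [Fintype α] [DecidableEq α] [DecidableEq ι] (i : ι)
    (f : ι → Finset α) : xorSum {i} f = f i := by
  rw [← insert_empty_eq, xorSum_insert (by simp), xorSum_empty]
  simp

end Counting

/-! ### Geometry of the code, and a flip with nearly private syndrome -/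

section Qubits

variable {A B : Type*} [Fintype A] [Fintype B] [DecidableEq A] [DecidableEq B]
variable {G : A → B → Prop} [DecidableRel G]

theorem mem_nbrLeft {a : A} {b : B} : b ∈ nbrLeft G a ↔ G a b := by simp [nbrLeft]

theorem mem_nbrRight {a : A} {b : B} : a ∈ nbrRight G b ↔ G a b := by simp [nbrRight]

theorem mem_gammaX_inl {α a : A} {c : A × B} :
    c ∈ gammaX G (Sum.inl (α, a)) ↔ c.1 = α ∧ G a c.2 := by
  obtain ⟨c1, c2⟩ := c
  rw [gammaX, Finset.mem_product, Finset.mem_singleton, mem_nbrLeft]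

theorem mem_gammaX_inr {b β : B} {c : A × B} :
    c ∈ gammaX G (Sum.inr (b, β)) ↔ G c.1 b ∧ c.2 = β := by
  obtain ⟨c1, c2⟩ := c
  rw [gammaX, Finset.mem_product, Finset.mem_singleton, mem_nbrRight]

theorem inl_mem_gammaZ {α a : A} {g : B × A} :
    (Sum.inl (α, a) : Qubit A B) ∈ gammaZ G g ↔ G α g.1 ∧ a = g.2 := by
  rw [gammaZ, Finset.inl_mem_disjSum, Finset.mem_product, Finset.mem_singleton, mem_nbrRight]

theorem inr_mem_gammaZ {b β : B} {g : B × A} :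
    (Sum.inr (b, β) : Qubit A B) ∈ gammaZ G g ↔ b = g.1 ∧ G g.2 β := by
  rw [gammaZ, Finset.inr_mem_disjSum, Finset.mem_product, Finset.mem_singleton, mem_nbrLeft]

theorem card_gammaX_le {dA dB : ℕ} (hG : IsBiregular G dA dB) (hAB : dA ≤ dB) (v : Qubit A B) :
    (gammaX G v).card ≤ dB := by
  rcases v with ⟨α, a⟩ | ⟨b, β⟩
  · simpa [gammaX, hG.1 a] using hAB
  · simp [gammaX, hG.2 b]

theorem card_gammaZ {dA dB : ℕ} (hG : IsBiregular G dA dB) (g : B × A) :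
    (gammaZ G g).card = dA + dB := by
  simp [gammaZ, hG.1, hG.2, add_comm]

/-- The set of checks adjacent to some qubit of `W`. -/
def checkNbhd (G : A → B → Prop) [DecidableRel G] (W : Finset (Qubit A B)) : Finset (A × B) :=
  W.biUnion (gammaX G)

theorem mem_checkNbhd {W : Finset (Qubit A B)} {c : A × B} :
    c ∈ checkNbhd G W ↔ ∃ v ∈ W, c ∈ gammaX G v := Finset.mem_biUnion

theorem checkNbhd_mono {W W' : Finset (Qubit A B)} (h : W ⊆ W') :
    checkNbhd G W ⊆ checkNbhd G W' := Finset.biUnion_subset_biUnion_of_subset_left _ h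

theorem card_checkNbhd_le {dA dB : ℕ} (hG : IsBiregular G dA dB) (hAB : dA ≤ dB)
    (W : Finset (Qubit A B)) : (checkNbhd G W).card ≤ dB * W.card := by
  rw [mul_comm]
  exact Finset.card_biUnion_le_card_mul _ _ _ fun v _ => card_gammaX_le hG hAB v

theorem mem_syndromeX {E : Finset (Qubit A B)} {c : A × B} :
    c ∈ syndromeX G E ↔ Odd (E.filter (fun v => c ∈ gammaX G v)).card := by
  simp [syndromeX, xorSum]

theorem syndromeX_symmDiff (E F : Finset (Qubit A B)) :
    syndromeX G (E ∆ F) = syndromeX G E ∆ syndromeX G F := xorSum_symmDiff _ _ _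

theorem syndromeX_empty : syndromeX G ∅ = ∅ := xorSum_empty _

theorem syndromeX_subset_checkNbhd (E : Finset (Qubit A B)) :
    syndromeX G E ⊆ checkNbhd G E := by
  intro c hc
  rw [mem_syndromeX] at hc
  obtain ⟨v, hv⟩ := Finset.card_pos.1 hc.pos
  rw [Finset.mem_filter] at hv
  exact mem_checkNbhd.2 ⟨v, hv⟩

theorem mem_syndromeX_iff_of_subset {W E : Finset (Qubit A B)} {c : A × B} (h : W ⊆ E)
    (hc : ∀ v ∈ E, c ∈ gammaX G v → v ∈ W) : c ∈ syndromeX G E ↔ c ∈ syndromeX G W := by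
  rw [mem_syndromeX, mem_syndromeX]
  have : E.filter (fun v => c ∈ gammaX G v) = W.filter (fun v => c ∈ gammaX G v) := by
    ext v
    simp only [Finset.mem_filter]
    exact ⟨fun hv => ⟨hc v hv.1 hv.2, hv.2⟩, fun hv => ⟨h hv.1, hv.2⟩⟩
  rw [this]

/-- The syndrome of a set of qubits in the support of the generator `(b, a)`. -/
theorem syndromeX_disjSum {a : A} {b : B} {x : Finset A} {y : Finset B}
    (hx : x ⊆ nbrRight G b) (hy : y ⊆ nbrLeft G a) :
    syndromeX G ((x ×ˢ {a}).disjSum ({b} ×ˢ y)) =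
      x ×ˢ (nbrLeft G a \ y) ∪ (nbrRight G b \ x) ×ˢ y := by
  ext ⟨α, β⟩
  -- A check meets at most two of these qubits, one through its row `α` and one through its column
  -- `β`.
  have hset : ((x ×ˢ {a}).disjSum ({b} ×ˢ y)).filter (fun v => (α, β) ∈ gammaX G v) =
      (if α ∈ x ∧ G a β then {Sum.inl (α, a)} else ∅) ∪
        (if β ∈ y ∧ G α b then {Sum.inr (b, β)} else ∅) := by
    ext v
    rw [Finset.mem_filter, Finset.mem_union]
    rcases v with ⟨α', a'⟩ | ⟨b', β'⟩
    · rw [mem_gammaX_inl]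
      by_cases h : α ∈ x ∧ G a β <;> by_cases h' : β ∈ y ∧ G α b <;> simp [h, h'] <;> aesop
    · rw [mem_gammaX_inr]
      by_cases h : α ∈ x ∧ G a β <;> by_cases h' : β ∈ y ∧ G α b <;> simp [h, h'] <;> aesop
  rw [mem_syndromeX, hset]
  have hx' : α ∈ x → G α b := fun h => mem_nbrRight.1 (hx h)
  have hy' : β ∈ y → G a β := fun h => mem_nbrLeft.1 (hy h)
  simp only [Finset.mem_union, Finset.mem_product, Finset.mem_sdiff, mem_nbrLeft, mem_nbrRight]
  by_cases h1 : α ∈ x <;> by_cases h2 : β ∈ y <;> by_cases h3 : G a β <;> by_cases h4 : G α b <;>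
    simp_all

theorem syndromeX_gammaZ (g : B × A) : syndromeX G (gammaZ G g) = ∅ := by
  rw [gammaZ, syndromeX_disjSum subset_rfl subset_rfl]
  simp

/-- Two qubits are adjacent if some generator of either type acts on both. -/
def QubitAdj (G : A → B → Prop) [DecidableRel G] (v w : Qubit A B) : Prop :=
  (∃ c, c ∈ gammaX G v ∧ c ∈ gammaX G w) ∨ ∃ g, v ∈ gammaZ G g ∧ w ∈ gammaZ G g

theorem QubitAdj.symm {v w : Qubit A B} (h : QubitAdj G v w) : QubitAdj G w v := by
  rcases h with ⟨c, h1, h2⟩ | ⟨g, h1, h2⟩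
  · exact Or.inl ⟨c, h2, h1⟩
  · exact Or.inr ⟨g, h2, h1⟩

-- At most `dB` generators of each type act on a qubit, and each acts on `dA + dB` qubits.
open Classical in
theorem card_qubitAdj_le {dA dB : ℕ} (hG : IsBiregular G dA dB) (hAB : dA ≤ dB) (v : Qubit A B) :
    (Finset.univ.filter (QubitAdj G v)).card ≤ 2 * (dB * (dA + dB)) := by
  let Q : A × B → Finset (Qubit A B) := fun c =>
    ({c.1} ×ˢ nbrRight G c.2).disjSum (nbrLeft G c.1 ×ˢ {c.2})
  have hQ : ∀ c, (Q c).card = dA + dB := fun c => by simp [Q, hG.1, hG.2, add_comm]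
  let Z : Qubit A B → Finset (B × A) :=
    Sum.elim (fun p => nbrLeft G p.1 ×ˢ {p.2}) (fun p => {p.1} ×ˢ nbrRight G p.2)
  have hZ : (Z v).card ≤ dB := by
    rcases v with ⟨α, a⟩ | ⟨b, β⟩
    · simpa [Z, hG.1] using hAB
    · simp [Z, hG.2]
  have hsub : Finset.univ.filter (QubitAdj G v) ⊆
      (gammaX G v).biUnion Q ∪ (Z v).biUnion (gammaZ G) := by
    intro w hw
    rw [Finset.mem_union, Finset.mem_biUnion, Finset.mem_biUnion]
    rcases (Finset.mem_filter.1 hw).2 with ⟨c, h1, h2⟩ | ⟨g, h1, h2⟩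
    · refine Or.inl ⟨c, h1, ?_⟩
      rcases w with ⟨α, a⟩ | ⟨b, β⟩
      · rw [mem_gammaX_inl] at h2
        simp [Q, mem_nbrRight, h2.1, h2.2]
      · rw [mem_gammaX_inr] at h2
        simp [Q, mem_nbrLeft, h2.1, h2.2]
    · refine Or.inr ⟨g, ?_, h2⟩
      rcases v with ⟨α, a⟩ | ⟨b, β⟩
      · rw [inl_mem_gammaZ] at h1
        simp [Z, mem_nbrLeft, h1.1, h1.2]
      · rw [inr_mem_gammaZ] at h1
        simp [Z, mem_nbrRight, h1.1, h1.2]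
  have h1 : ((gammaX G v).biUnion Q).card ≤ dB * (dA + dB) :=
    (Finset.card_biUnion_le_card_mul _ _ _ fun c _ => (hQ c).le).trans
      (Nat.mul_le_mul_right _ (card_gammaX_le hG hAB v))
  have h2 : ((Z v).biUnion (gammaZ G)).card ≤ dB * (dA + dB) :=
    (Finset.card_biUnion_le_card_mul _ _ _ fun g _ => (card_gammaZ hG g).le).trans
      (Nat.mul_le_mul_right _ hZ)
  have := (Finset.card_le_card hsub).trans (Finset.card_union_le _ _)
  omega

/-- The weighted size of a set of qubits, under which both halves of a generator have weight
`dA * dB`. -/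
def qubitWeight (dA dB : ℕ) (R : Finset (Qubit A B)) : ℕ :=
  ∑ v ∈ R, Sum.elim (fun _ => dA) (fun _ => dB) v

theorem qubitWeight_mono {dA dB : ℕ} {R R' : Finset (Qubit A B)} (h : R ⊆ R') :
    qubitWeight dA dB R ≤ qubitWeight dA dB R' :=
  Finset.sum_le_sum_of_subset h

theorem qubitWeight_disjSum {dA dB : ℕ} (s : Finset (A × A)) (t : Finset (B × B)) :
    qubitWeight dA dB (s.disjSum t) = dA * s.card + dB * t.card := by
  simp [qubitWeight, Finset.sum_disjSum, mul_comm]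

theorem qubitWeight_gammaZ {dA dB : ℕ} (hG : IsBiregular G dA dB) (g : B × A) :
    qubitWeight dA dB (gammaZ G g) = 2 * (dA * dB) := by
  rw [gammaZ, qubitWeight_disjSum]
  simp [hG.1, hG.2]
  ring

theorem qubitWeight_symmDiff_add {dA dB : ℕ} (R T : Finset (Qubit A B)) :
    qubitWeight dA dB (R ∆ T) + 2 * qubitWeight dA dB (R ∩ T) =
      qubitWeight dA dB R + qubitWeight dA dB T := by
  have h1 : qubitWeight dA dB (R ∆ T) = qubitWeight dA dB (R \ T) + qubitWeight dA dB (T \ R) :=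
    Finset.sum_union disjoint_sdiff_sdiff
  have h2 : qubitWeight dA dB (R ∩ T) + qubitWeight dA dB (R \ T) = qubitWeight dA dB R :=
    Finset.sum_inter_add_sum_sdiff R T _
  have h3 : qubitWeight dA dB (T ∩ R) + qubitWeight dA dB (T \ R) = qubitWeight dA dB T :=
    Finset.sum_inter_add_sum_sdiff T R _
  rw [Finset.inter_comm] at h3
  omega

theorem qubitWeight_le {dA dB : ℕ} (hAB : dA ≤ dB) (R : Finset (Qubit A B)) :
    qubitWeight dA dB R ≤ dB * R.card := by
  rw [mul_comm]
  refine Finset.sum_le_card_nsmul R _ dB fun v _ => ?_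
  rcases v with v | v
  · exact hAB
  · exact le_rfl

/-- No single `X`-type generator decreases the weight of `R`. -/
def IsReducedError (G : A → B → Prop) [DecidableRel G] (dA dB : ℕ) (R : Finset (Qubit A B)) : Prop :=
  ∀ g, qubitWeight dA dB (R ∩ gammaZ G g) ≤ dA * dB

theorem IsReducedError.mono {dA dB : ℕ} {R R' : Finset (Qubit A B)} (h : IsReducedError G dA dB R)
    (hR : R' ⊆ R) : IsReducedError G dA dB R' := fun g =>
  (qubitWeight_mono (Finset.inter_subset_inter_right hR)).trans (h g)

/-- If almost all neighbours of `a` and `b` see `W` only through the generator `(b, a)`, then the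
part of `W` on these neighbours is a flip whose syndrome is almost untouched by the rest of `W`. -/
theorem exists_isFlip_of_private {dA dB : ℕ} (hdA : 0 < dA) (hAB : dA ≤ dB) {δ : ℝ} (hδ : 0 ≤ δ)
    {W : Finset (Qubit A B)} (hW : IsReducedError G dA dB W) {a : A} {b : B}
    {Ua : Finset B} {Ub : Finset A} (hG : IsBiregular G dA dB)
    (hUa : Ua ⊆ nbrLeft G a) (hUb : Ub ⊆ nbrRight G b)
    (hUac : ((nbrLeft G a \ Ua).card : ℝ) ≤ 2 * δ * dA)
    (hUbc : ((nbrRight G b \ Ub).card : ℝ) ≤ 2 * δ * dB)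
    (hA : ∀ a', ∀ α ∈ Ub, ∀ β ∈ Ua, Sum.inl (α, a') ∈ W → G a' β → a' = a)
    (hB : ∀ b', ∀ α ∈ Ub, ∀ β ∈ Ua, Sum.inr (b', β) ∈ W → G α b' → b' = b)
    (hne : (∃ α ∈ Ub, Sum.inl (α, a) ∈ W) ∨ ∃ β ∈ Ua, Sum.inr (b, β) ∈ W) :
    ∃ F ⊆ W, IsFlip G dA F ∧
      ((syndromeX G F ∩ checkNbhd G (W \ F)).card : ℝ) ≤ 4 * δ * (syndromeX G F).card := by
  set x := Ub.filter (fun α => Sum.inl (α, a) ∈ W) with hx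
  set y := Ua.filter (fun β => Sum.inr (b, β) ∈ W) with hy
  have hxU : x ⊆ Ub := Finset.filter_subset _ _
  have hyU : y ⊆ Ua := Finset.filter_subset _ _
  have hxb : x ⊆ nbrRight G b := hxU.trans hUb
  have hya : y ⊆ nbrLeft G a := hyU.trans hUa
  set F : Finset (Qubit A B) := (x ×ˢ {a}).disjSum ({b} ×ˢ y) with hF
  have hFW : F ⊆ W := by
    rintro (⟨α, a'⟩ | ⟨b', β⟩) h
    · obtain ⟨h1, rfl⟩ : α ∈ x ∧ a' = a := by simpa [hF, eq_comm] using h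
      exact (Finset.mem_filter.1 h1).2
    · obtain ⟨h1, rfl⟩ : β ∈ y ∧ b' = b := by simpa [hF, and_comm, eq_comm] using h
      exact (Finset.mem_filter.1 h1).2
  have hFg : F ⊆ gammaZ G (b, a) := by
    refine Finset.disjSum_mono ?_ ?_
    · exact Finset.product_subset_product hxb subset_rfl
    · exact Finset.product_subset_product subset_rfl hya
  have hsyn : syndromeX G F = x ×ˢ (nbrLeft G a \ y) ∪ (nbrRight G b \ x) ×ˢ y :=
    syndromeX_disjSum hxb hya
  have hdisj : Disjoint (x ×ˢ (nbrLeft G a \ y)) ((nbrRight G b \ x) ×ˢ y) :=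
    Finset.disjoint_product.2 (Or.inl Finset.disjoint_sdiff)
  have hXle : x.card ≤ dB := (Finset.card_le_card hxb).trans (hG.2 b).le
  have hYle : y.card ≤ dA := (Finset.card_le_card hya).trans (hG.1 a).le
  have hcard : ((syndromeX G F).card : ℝ) =
      x.card * (dA - y.card) + (dB - x.card) * y.card := by
    rw [hsyn, Finset.card_union_of_disjoint hdisj, Finset.card_product, Finset.card_product,
      Finset.card_sdiff_of_subset hxb, Finset.card_sdiff_of_subset hya, hG.1, hG.2]
    push_cast [Nat.cast_sub hXle, Nat.cast_sub hYle]
    ring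
  have hwt : dA * x.card + dB * y.card ≤ dA * dB := by
    have h1 : qubitWeight dA dB F = dA * x.card + dB * y.card := by
      rw [hF, qubitWeight_disjSum]; simp
    rw [← h1]
    exact (qubitWeight_mono (Finset.subset_inter hFW hFg)).trans (hW (b, a))
  have hX0 : (0 : ℝ) ≤ x.card := Nat.cast_nonneg _
  have hY0 : (0 : ℝ) ≤ y.card := Nat.cast_nonneg _
  have hdA' : (0 : ℝ) < dA := by exact_mod_cast hdA
  have hAB' : (dA : ℝ) ≤ dB := by exact_mod_cast hAB
  have hwt' : (dA : ℝ) * x.card + dB * y.card ≤ dA * dB := by exact_mod_cast hwt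
  -- The syndrome has size `dA|x| + dB|y| - 2|x||y|`. By AM-GM and the weight bound `dA|x| + dB|y| ≤
  -- dA dB` of a reduced error, the cross term costs at most half.
  have hhalf : (dA * x.card + dB * y.card : ℝ) / 2 ≤ (syndromeX G F).card := by
    rw [hcard]
    have h4 : 4 * ((x.card : ℝ) * y.card) ≤ dA * x.card + dB * y.card := by
      have h5 : 4 * ((dA * x.card : ℝ) * (dB * y.card)) ≤ (dA * x.card + dB * y.card) ^ 2 := by
        nlinarith [sq_nonneg (dA * x.card - dB * y.card : ℝ)]
      have h6 : (dA * x.card + dB * y.card : ℝ) ^ 2 ≤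
          (dA * dB) * (dA * x.card + dB * y.card) := by
        rw [sq]
        exact mul_le_mul_of_nonneg_right hwt' (by positivity)
      have h7 : (0 : ℝ) < dA * dB := mul_pos hdA' (hdA'.trans_le hAB')
      refine le_of_mul_le_mul_left ?_ h7
      linarith
    nlinarith
  refine ⟨F, hFW, ⟨?_, ⟨(b, a), hFg⟩, ?_⟩, ?_⟩
  · rcases hne with ⟨α, h1, h2⟩ | ⟨β, h1, h2⟩
    · exact ⟨Sum.inl (α, a), by simp [hF, hx, h1, h2]⟩
    · exact ⟨Sum.inr (b, β), by simp [hF, hy, h1, h2]⟩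
  · refine le_trans ?_ hhalf
    have : (F.card : ℝ) = x.card + y.card := by simp [hF]
    rw [this]
    nlinarith
  -- A check of `σ_X(F)` also seen by `W \ F` lies outside `Ub × Ua`. There are at most `2δ(dA|x| +
  -- dB|y|)` such checks, and `hhalf` bounds this by `4δ|σ_X(F)|`.
  · have hsub : syndromeX G F ∩ checkNbhd G (W \ F) ⊆
        x ×ˢ (nbrLeft G a \ Ua) ∪ (nbrRight G b \ Ub) ×ˢ y := by
      rintro ⟨α, β⟩ h
      obtain ⟨h1, h2⟩ := Finset.mem_inter.1 h
      obtain ⟨v, hv, hvc⟩ := mem_checkNbhd.1 h2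
      obtain ⟨hvW, hvF⟩ := Finset.mem_sdiff.1 hv
      have hU : ¬ (α ∈ Ub ∧ β ∈ Ua) := by
        rintro ⟨hα, hβ⟩
        rcases v with ⟨α', a'⟩ | ⟨b', β'⟩
        · obtain ⟨rfl, h4⟩ := mem_gammaX_inl.1 hvc
          obtain rfl := hA a' _ hα _ hβ hvW h4
          exact hvF (by simpa [hF, hx] using ⟨hα, hvW⟩)
        · obtain ⟨h4, rfl⟩ := mem_gammaX_inr.1 hvc
          obtain rfl := hB b' _ hα _ hβ hvW h4
          exact hvF (by simpa [hF, hy] using ⟨hβ, hvW⟩)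
      rw [hsyn, Finset.mem_union, Finset.mem_product, Finset.mem_product] at h1
      rw [Finset.mem_union, Finset.mem_product, Finset.mem_product]
      simp only [Finset.mem_sdiff] at h1 ⊢
      rcases h1 with h1 | h1
      · exact Or.inl ⟨h1.1, h1.2.1, fun hβ => hU ⟨hxU h1.1, hβ⟩⟩
      · exact Or.inr ⟨⟨h1.1.1, fun hα => hU ⟨hα, hyU h1.2⟩⟩, h1.2⟩
    have hc := (Finset.card_le_card hsub).trans (Finset.card_union_le _ _)
    rw [Finset.card_product, Finset.card_product] at hc
    have hc' : ((syndromeX G F ∩ checkNbhd G (W \ F)).card : ℝ) ≤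
        x.card * (nbrLeft G a \ Ua).card + (nbrRight G b \ Ub).card * y.card := by
      exact_mod_cast hc
    have h1 := mul_le_mul_of_nonneg_left hUac hX0
    have h2 := mul_le_mul_of_nonneg_right hUbc hY0
    have h3 := mul_le_mul_of_nonneg_left hhalf hδ
    linarith

end Qubits

/-! ### A decoder that is stuck: syndrome errors pay for the residual error -/

section Stuck

variable {A B : Type*} [Fintype A] [Fintype B] [DecidableEq A] [DecidableEq B]
variable {G : A → B → Prop} [DecidableRel G]

/-- A nonempty reduced error of small size contains a flip whose syndrome is almost untouched by
the rest of the error. -/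
theorem exists_isFlip_of_card_le {dA dB : ℕ} (hdA : 0 < dA) (hAB : dA ≤ dB) {γ δ : ℝ}
    (hδ : 0 ≤ δ) (hG : IsBiregular G dA dB) (hE : IsExpanding G dA dB γ δ)
    {W : Finset (Qubit A B)} (hW : IsReducedError G dA dB W) (hne : W.Nonempty)
    (hWA : (W.card : ℝ) ≤ γ * Fintype.card A) (hWB : (W.card : ℝ) ≤ γ * Fintype.card B) :
    ∃ F ⊆ W, IsFlip G dA F ∧
      ((syndromeX G F ∩ checkNbhd G (W \ F)).card : ℝ) ≤ 4 * δ * (syndromeX G F).card := by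
  have hdA' : (0 : ℝ) ≤ dA := Nat.cast_nonneg _
  have hdB' : (0 : ℝ) ≤ dB := Nat.cast_nonneg _
  have hδA : 0 ≤ 2 * δ * dA := by positivity
  have hδB : 0 ≤ 2 * δ * dB := by positivity
  have hunB : ∀ S : Finset B, S.Nonempty → S.card ≤ W.card → ∃ b ∈ S, ∃ U ⊆ nbrRight G b,
      ((nbrRight G b \ U).card : ℝ) ≤ 2 * δ * dB ∧
        ∀ α ∈ U, ∀ b' ∈ S, G α b' → b' = b := by
    intro S hS hSW
    obtain ⟨b, hb, hc⟩ := exists_card_shared_le hS (nbrRight G) (fun b _ => hG.2 b)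
      (hE.2 S (le_trans (by exact_mod_cast hSW) hWB))
    refine ⟨b, hb, _, Finset.sdiff_subset (t := (nbrRight G b).filter
      (fun x => ∃ j ∈ S, j ≠ b ∧ x ∈ nbrRight G j)), ?_, ?_⟩
    · rwa [Finset.sdiff_sdiff_eq_self (Finset.filter_subset _ _)]
    · intro α hα b' hb' h
      by_contra hbb
      obtain ⟨h1, h2⟩ := Finset.mem_sdiff.1 hα
      exact h2 (Finset.mem_filter.2 ⟨h1, b', hb', hbb, mem_nbrRight.2 h⟩)
  by_cases hleft : ∃ α a, Sum.inl (α, a) ∈ W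
  · have hSne : (W.toLeft.image Prod.snd).Nonempty := by
      obtain ⟨α, a, h⟩ := hleft
      exact ⟨a, Finset.mem_image.2 ⟨(α, a), Finset.mem_toLeft.2 h, rfl⟩⟩
    have hSc : (W.toLeft.image Prod.snd).card ≤ W.card :=
      Finset.card_image_le.trans Finset.card_toLeft_le
    obtain ⟨a, ha, hc⟩ := exists_card_shared_le hSne (nbrLeft G) (fun a _ => hG.1 a)
      (hE.1 _ (le_trans (by exact_mod_cast hSc) hWA))
    obtain ⟨⟨α₀, a₀⟩, hα₀, rfl⟩ := Finset.mem_image.1 ha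
    rw [Finset.mem_toLeft] at hα₀
    simp only at hc ha
    set bad := (nbrLeft G a₀).filter
      (fun x => ∃ j ∈ W.toLeft.image Prod.snd, j ≠ a₀ ∧ x ∈ nbrLeft G j) with hbad
    set U := nbrLeft G a₀ \ bad with hU
    have hUc : ((nbrLeft G a₀ \ U).card : ℝ) ≤ 2 * δ * dA := by
      rwa [Finset.sdiff_sdiff_eq_self (Finset.filter_subset _ _)]
    have hUu : ∀ a', ∀ α, ∀ β ∈ U, Sum.inl (α, a') ∈ W → G a' β → a' = a₀ := by
      intro a' α β hβ hmem h
      by_contra haa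
      obtain ⟨h1, h2⟩ := Finset.mem_sdiff.1 hβ
      exact h2 (Finset.mem_filter.2 ⟨h1, a', Finset.mem_image.2 ⟨(α, a'),
        Finset.mem_toLeft.2 hmem, rfl⟩, haa, mem_nbrLeft.2 h⟩)
    -- Only `B²` qubits in the private columns `U` can interfere. Choosing `b` among those
    -- guarantees a nonempty flip. If there are none, any neighbour `b` of `α₀` will do, and `(α₀,
    -- a₀)` makes the flip nonempty.
    by_cases hright : ((W.toRight.filter (fun p => p.2 ∈ U)).image Prod.fst).Nonempty
    · obtain ⟨b, hb, Ub, hUb, hUbc, hUbu⟩ := hunB _ hright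
        (Finset.card_image_le.trans ((Finset.card_filter_le _ _).trans Finset.card_toRight_le))
      refine exists_isFlip_of_private hdA hAB hδ hW hG Finset.sdiff_subset hUb hUc hUbc
        (fun a' α _ β hβ => hUu a' α β hβ) ?_ (Or.inr ?_)
      · intro b' α hα β hβ hmem h
        exact hUbu α hα b' (Finset.mem_image.2 ⟨(b', β), Finset.mem_filter.2
          ⟨Finset.mem_toRight.2 hmem, hβ⟩, rfl⟩) h
      · obtain ⟨⟨b, β⟩, h1, rfl⟩ := Finset.mem_image.1 hb
        obtain ⟨h1, h2⟩ := Finset.mem_filter.1 h1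
        exact ⟨β, h2, Finset.mem_toRight.1 h1⟩
    · obtain ⟨b, hb⟩ := Finset.card_pos.1 (hdA.trans_le (hG.1 α₀).ge)
      refine exists_isFlip_of_private (b := b) hdA hAB hδ hW hG Finset.sdiff_subset subset_rfl hUc
        (by simpa using hδB) (fun a' α _ β hβ => hUu a' α β hβ) ?_
        (Or.inl ⟨α₀, mem_nbrRight.2 (mem_nbrLeft.1 hb), hα₀⟩)
      intro b' α _ β hβ hmem h
      exact absurd ⟨b', Finset.mem_image.2 ⟨(b', β), Finset.mem_filter.2
          ⟨Finset.mem_toRight.2 hmem, hβ⟩, rfl⟩⟩ hright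
  · have hSne : (W.toRight.image Prod.fst).Nonempty := by
      obtain ⟨⟨α, a⟩ | ⟨b, β⟩, h⟩ := hne
      · exact absurd ⟨α, a, h⟩ hleft
      · exact ⟨b, Finset.mem_image.2 ⟨(b, β), Finset.mem_toRight.2 h, rfl⟩⟩
    obtain ⟨b, hb, Ub, hUb, hUbc, hUbu⟩ := hunB _ hSne
      (Finset.card_image_le.trans Finset.card_toRight_le)
    obtain ⟨⟨b₀, β₀⟩, hβ₀, rfl⟩ := Finset.mem_image.1 hb
    rw [Finset.mem_toRight] at hβ₀
    obtain ⟨a, ha⟩ := Finset.card_pos.1 ((hdA.trans_le hAB).trans_le (hG.2 β₀).ge)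
    refine exists_isFlip_of_private (a := a) hdA hAB hδ hW hG subset_rfl hUb
      (by simpa using hδA) hUbc (fun a' α _ β _ h _ => absurd ⟨α, a', h⟩ hleft) ?_
      (Or.inr ⟨β₀, mem_nbrLeft.2 (mem_nbrRight.1 ha), hβ₀⟩)
    intro b' α hα β hβ hmem h
    exact hUbu α hα b' (Finset.mem_image.2 ⟨(b', β), Finset.mem_toRight.2 hmem, rfl⟩) h

/-- All connected components of `W` have at most `t` elements. -/
def HasSmallComponents (G : A → B → Prop) [DecidableRel G] (t : ℝ) (W : Finset (Qubit A B)) :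
    Prop :=
  ∀ x ∈ W, ∃ K : Finset (Qubit A B), x ∈ K ∧ (K.card : ℝ) ≤ t ∧
    ∀ y ∈ K, ∀ z ∈ W, QubitAdj G y z → z ∈ K

theorem HasSmallComponents.mono {t : ℝ} {W W' : Finset (Qubit A B)}
    (h : HasSmallComponents G t W) (hW : W' ⊆ W) : HasSmallComponents G t W' := by
  intro x hx
  obtain ⟨K, h1, h2, h3⟩ := h x (hW hx)
  exact ⟨K, h1, h2, fun y hy z hz => h3 y hy z (hW hz)⟩

/-- Expansion is needed only within one component: a flip found there shares no check with the rest
of `W`. -/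
theorem exists_isFlip_of_hasSmallComponents {dA dB : ℕ} (hdA : 0 < dA) (hAB : dA ≤ dB) {γ δ t : ℝ}
    (hδ : 0 ≤ δ) (hG : IsBiregular G dA dB) (hE : IsExpanding G dA dB γ δ)
    (htA : t ≤ γ * Fintype.card A) (htB : t ≤ γ * Fintype.card B)
    {W : Finset (Qubit A B)} (hW : IsReducedError G dA dB W) (hne : W.Nonempty)
    (hsmall : HasSmallComponents G t W) :
    ∃ F ⊆ W, IsFlip G dA F ∧
      ((syndromeX G F ∩ checkNbhd G (W \ F)).card : ℝ) ≤ 4 * δ * (syndromeX G F).card := by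
  obtain ⟨x, hx⟩ := hne
  obtain ⟨K, hxK, hKt, hK⟩ := hsmall x hx
  have hc : ((W ∩ K).card : ℝ) ≤ t :=
    le_trans (by exact_mod_cast Finset.card_le_card Finset.inter_subset_right) hKt
  obtain ⟨F, hF, hflip, hFc⟩ := exists_isFlip_of_card_le hdA hAB hδ hG hE
    (hW.mono (Finset.inter_subset_left (s₂ := K))) ⟨x, Finset.mem_inter.2 ⟨hx, hxK⟩⟩
    (hc.trans htA) (hc.trans htB)
  refine ⟨F, hF.trans Finset.inter_subset_left, hflip, le_trans ?_ hFc⟩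
  rw [Nat.cast_le]
  refine Finset.card_le_card fun c hcc => ?_
  obtain ⟨h1, h2⟩ := Finset.mem_inter.1 hcc
  obtain ⟨u, hu, huc⟩ := mem_checkNbhd.1 (syndromeX_subset_checkNbhd F h1)
  obtain ⟨v, hv, hvc⟩ := mem_checkNbhd.1 h2
  obtain ⟨hvW, hvF⟩ := Finset.mem_sdiff.1 hv
  have hvK := hK u (Finset.mem_inter.1 (hF hu)).2 v hvW (Or.inl ⟨c, huc, hvc⟩)
  exact Finset.mem_inter.2 ⟨h1, mem_checkNbhd.2 ⟨v, Finset.mem_sdiff.2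
    ⟨Finset.mem_inter.2 ⟨hvW, hvK⟩, hvF⟩, hvc⟩⟩

/-- Peeling off the flips one by one: if no flip inside `W` meets `σ` in more than the fraction
`(1 + β) / 2` of its syndrome, the same holds for a set `T` of checks which contains most of the
syndromes of the peeled flips and almost agrees there with the syndrome of `W`. -/
theorem exists_peeling {dA dB : ℕ} (hdA : 0 < dA) (hAB : dA ≤ dB) {γ δ t β : ℝ}
    (hδ : 0 ≤ δ) (hG : IsBiregular G dA dB) (hE : IsExpanding G dA dB γ δ)
    (htA : t ≤ γ * Fintype.card A) (htB : t ≤ γ * Fintype.card B) (σ : Finset (A × B))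
    (hσ : ∀ F, IsFlip G dA F →
      ((σ ∩ syndromeX G F).card : ℝ) ≤ (1 + β) / 2 * (syndromeX G F).card)
    (W : Finset (Qubit A B)) :
    IsReducedError G dA dB W → HasSmallComponents G t W →
    ∃ T ⊆ checkNbhd G W, ∃ M : ℝ, (dA : ℝ) / 2 * W.card ≤ M ∧
      ((T \ syndromeX G W).card : ℝ) ≤ 4 * δ * M ∧ (1 - 4 * δ) * M ≤ T.card ∧
      ((σ ∩ T).card : ℝ) ≤ (1 + β) / 2 * M := by
  induction W using Finset.strongInduction with
  | H W ih =>
  intro hW hsmall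
  rcases W.eq_empty_or_nonempty with rfl | hne
  · exact ⟨∅, by simp, 0, by simp⟩
  obtain ⟨F, hFW, hflip, hF⟩ :=
    exists_isFlip_of_hasSmallComponents hdA hAB hδ hG hE htA htB hW hne hsmall
  have hss : W \ F ⊂ W := Finset.sdiff_ssubset hFW hflip.1
  obtain ⟨T, hTW, M, h1, h2, h3, h4⟩ := ih _ hss (hW.mono hss.1) (hsmall.mono hss.1)
  set s := syndromeX G F with hs
  set N := checkNbhd G (W \ F) with hN
  have hsW : syndromeX G W = syndromeX G (W \ F) ∆ s := by
    rw [hs, ← syndromeX_symmDiff]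
    congr 1
    ext x
    have := @hFW x
    simp only [Finset.mem_symmDiff, Finset.mem_sdiff]
    tauto
  have hsc : ((s \ N).card : ℝ) + (s ∩ N).card = s.card := by
    exact_mod_cast Finset.card_sdiff_add_card_inter s N
  have hdisj : Disjoint T (s \ N) :=
    Finset.disjoint_of_subset_left hTW Finset.disjoint_sdiff
  -- `M` accumulates the syndrome sizes of the peeled flips. The new part `s \ N` is disjoint from
  -- `T` and lies in `σ_X(W)`, since `σ_X(W \ F) ⊆ N`. Restoring `F` can remove from the syndrome
  -- only checks of `s ∩ N`, at most `4δ|s|` of them.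
  refine ⟨T ∪ (s \ N), ?_, M + s.card, ?_, ?_, ?_, ?_⟩
  · refine Finset.union_subset (hTW.trans (checkNbhd_mono hss.1)) ?_
    exact Finset.sdiff_subset.trans ((syndromeX_subset_checkNbhd F).trans (checkNbhd_mono hFW))
  · have hc : (W.card : ℝ) = (W \ F).card + F.card := by
      exact_mod_cast (Finset.card_sdiff_add_card_eq_card hFW).symm
    rw [hc]
    have := hflip.2.2
    linarith
  · have hsub : (T ∪ (s \ N)) \ syndromeX G W ⊆ (T \ syndromeX G (W \ F)) ∪ (s ∩ N) := by
      intro c hc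
      have h5 := @hTW c
      have h6 := @syndromeX_subset_checkNbhd _ _ _ _ _ _ G _ (W \ F) c
      rw [hsW] at hc
      simp only [Finset.mem_sdiff, Finset.mem_union, Finset.mem_symmDiff, Finset.mem_inter] at hc ⊢
      tauto
    have hc := (Finset.card_le_card hsub).trans (Finset.card_union_le _ _)
    have hc' : (((T ∪ (s \ N)) \ syndromeX G W).card : ℝ) ≤
      (T \ syndromeX G (W \ F)).card + (s ∩ N).card := by exact_mod_cast hc
    linarith
  · rw [Finset.card_union_of_disjoint hdisj]
    push_cast
    linarith
  · have hsub : σ ∩ (T ∪ (s \ N)) ⊆ (σ ∩ T) ∪ (σ ∩ s) := by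
      intro c hc
      simp only [Finset.mem_sdiff, Finset.mem_union, Finset.mem_inter] at hc ⊢
      tauto
    have hc := (Finset.card_le_card hsub).trans (Finset.card_union_le _ _)
    have hc' : ((σ ∩ (T ∪ (s \ N))).card : ℝ) ≤ (σ ∩ T).card + (σ ∩ s).card := by
      exact_mod_cast hc
    have := hσ F hflip
    linarith

/-- With `s = σ_X(F)`, the decrease `|σ| - |σ ⊕ s|` equals `2|σ ∩ s| - |s|`. -/
theorem card_inter_le_of_not_canFlip {dA : ℕ} {β : ℝ} {σ : Finset (A × B)}
    {F : Finset (Qubit A B)} (hF : IsFlip G dA F) (h : ¬ CanFlip G dA β σ F) :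
    ((σ ∩ syndromeX G F).card : ℝ) ≤ (1 + β) / 2 * (syndromeX G F).card := by
  have h1 : ¬ β * ((syndromeX G F).card : ℝ) ≤ (syndromeDecrease G σ F : ℝ) :=
    fun h2 => h ⟨hF, h2⟩
  have h2 : ((σ ∆ syndromeX G F).card : ℝ) + 2 * (σ ∩ syndromeX G F).card =
      σ.card + (syndromeX G F).card := by
    exact_mod_cast Finset.card_symmDiff_add_two_mul σ (syndromeX G F)
  rw [syndromeDecrease] at h1
  push_cast at h1
  linarith

/-- If no flip is possible, then every union of components of the reduced residual error is paid
for by the syndrome errors in its neighbourhood. -/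
theorem card_le_of_not_canFlip {dA dB : ℕ} (hdA : 0 < dA) (hAB : dA ≤ dB) {γ δ t β : ℝ}
    (hδ : 0 ≤ δ) (hβ : β < betaOne δ) (hG : IsBiregular G dA dB) (hE : IsExpanding G dA dB γ δ)
    (htA : t ≤ γ * Fintype.card A) (htB : t ≤ γ * Fintype.card B)
    {R : Finset (Qubit A B)} {D : Finset (A × B)} (hR : IsReducedError G dA dB R)
    (hsmall : HasSmallComponents G t R)
    (hterm : ¬ ∃ F, CanFlip G dA β (syndromeX G R ∆ D) F)
    {W : Finset (Qubit A B)} (hW : IsSeparated (QubitAdj G) R W) :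
    (W.card : ℝ) ≤ cZero dA δ β * (D ∩ checkNbhd G W).card := by
  obtain ⟨T, hT, M, h1, h2, h3, h4⟩ := exists_peeling hdA hAB hδ hG hE htA htB
    (syndromeX G R ∆ D) (fun F hF => card_inter_le_of_not_canFlip hF fun h => hterm ⟨F, h⟩) W
    (hR.mono hW.1) (hsmall.mono hW.1)
  -- Near `W` the syndromes of `R` and `W` agree, so a check of `σ_X(W)` missing from the observed
  -- syndrome must belong to `D`.
  have hsub : T ⊆ ((syndromeX G R ∆ D) ∩ T) ∪ (T \ syndromeX G W) ∪ (D ∩ checkNbhd G W) := by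
    intro c hc
    have h5 := hT hc
    have h6 : c ∈ syndromeX G R ↔ c ∈ syndromeX G W := by
      refine mem_syndromeX_iff_of_subset hW.1 fun v hv hvc => ?_
      obtain ⟨u, hu, huc⟩ := mem_checkNbhd.1 h5
      exact hW.2 u hu v hv (Or.inl ⟨c, huc, hvc⟩)
    simp only [Finset.mem_union, Finset.mem_inter, Finset.mem_sdiff, Finset.mem_symmDiff]
    tauto
  have hc := (Finset.card_le_card hsub).trans ((Finset.card_union_le _ _).trans
    (Nat.add_le_add_right (Finset.card_union_le _ _) _))
  have hc' : (T.card : ℝ) ≤ ((syndromeX G R ∆ D) ∩ T).card + (T \ syndromeX G W).card +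
    (D ∩ checkNbhd G W).card := by exact_mod_cast hc
  have hb : 0 < betaOne δ - β := sub_pos.2 hβ
  have hd : (0 : ℝ) < dA := by exact_mod_cast hdA
  -- The three losses combine to `(1 - 4δ) - 4δ - (1 + β)/2 = (β₁ - β)/2`. With `M ≥ (dA/2)|W|` this
  -- gives `c₀`.
  have h7 : (betaOne δ - β) / 2 * M ≤ (D ∩ checkNbhd G W).card := by
    unfold betaOne
    linarith
  have h8 := mul_le_mul_of_nonneg_left h1 (half_pos hb).le
  rw [cZero, div_mul_eq_mul_div, le_div_iff₀ (by positivity)]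
  linarith

end Stuck

/-! ### Locality: the region touched by the decoder has heavy components -/

section Locality

theorem IsSeparated.inter_left {V : Type*} [DecidableEq V] {H : V → V → Prop} {U U' K : Finset V}
    (h : IsSeparated H U' K) (hU : U ⊆ U') : IsSeparated H U (K ∩ U) :=
  ⟨Finset.inter_subset_right, fun x hx y hy hxy => Finset.mem_inter.2
    ⟨h.2 x (Finset.mem_inter.1 hx).1 y (hU hy) hxy, hy⟩⟩

variable {A B : Type*} [Fintype A] [Fintype B] [DecidableEq A] [DecidableEq B]
variable {G : A → B → Prop} [DecidableRel G]

/-- The qubits of `F` are pairwise adjacent through `g`, so a flip is charged to a single component.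
-/
theorem IsSeparated.subset_or_disjoint {U K F : Finset (Qubit A B)} {g : B × A}
    (h : IsSeparated (QubitAdj G) U K) (hF : F ⊆ gammaZ G g) (hFU : F ⊆ U) :
    F ⊆ K ∨ Disjoint F K := by
  by_cases hd : Disjoint F K
  · exact Or.inr hd
  obtain ⟨x, hxF, hxK⟩ := Finset.not_disjoint_iff.1 hd
  exact Or.inl fun y hy => h.2 x hxK y (hFU hy) (Or.inr ⟨g, hF hxF, hF hy⟩)

theorem IsSeparated.mem_syndromeX_iff {U K R : Finset (Qubit A B)} {c : A × B}
    (h : IsSeparated (QubitAdj G) U K) (hR : R ⊆ U) (hc : c ∈ checkNbhd G K) :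
    c ∈ syndromeX G R ↔ c ∈ syndromeX G (R ∩ K) := by
  refine mem_syndromeX_iff_of_subset Finset.inter_subset_left fun v hv hvc => ?_
  obtain ⟨u, hu, huc⟩ := mem_checkNbhd.1 hc
  exact Finset.mem_inter.2 ⟨hv, h.2 u hu v (hR hv) (Or.inl ⟨c, huc, hvc⟩)⟩

/-- Along any run of the decoder there is a set `U` that contains all flips and each of whose
components is paid for by the errors in the component. -/
theorem DecoderStep.exists_region {dA dB : ℕ} (hdA : 0 < dA) (hAB : dA ≤ dB) {β : ℝ} (hβ : 0 < β)
    (hG : IsBiregular G dA dB) {E : Finset (Qubit A B)} {D : Finset (A × B)}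
    {s : Finset (Qubit A B) × Finset (A × B)}
    (h : Relation.ReflTransGen (DecoderStep G dA β) (∅, syndromeX G E ∆ D) s) :
    s.2 = syndromeX G (E ∆ s.1) ∆ D ∧
    ∃ U, E ⊆ U ∧ E ∆ s.1 ⊆ U ∧ ∀ K, IsSeparated (QubitAdj G) U K →
      (K.card : ℝ) + 2 / (β * dA) * (s.2 ∩ checkNbhd G K).card ≤
        (1 + 2 / (β * dA) * dB) * (E ∩ K).card + 2 / (β * dA) * (D ∩ checkNbhd G K).card := by
  have hd : (0 : ℝ) < dA := by exact_mod_cast hdA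
  -- A flip `F` lowers the syndrome by at least `(β dA / 2)|F|`, so weight `k` per syndrome element
  -- pays for the at most `|F|` qubits that join `U`.
  set k : ℝ := 2 / (β * dA) with hk
  have hk0 : 0 < k := by positivity
  induction h with
  | refl =>
    have hE0 : E ∆ ∅ = E := symmDiff_bot E
    refine ⟨by simp only [hE0], E, subset_rfl, hE0.subset, fun K hK => ?_⟩
    have hEK : E ∩ K = K := Finset.inter_eq_right.2 hK.1
    have hsub : (syndromeX G E ∆ D) ∩ checkNbhd G K ⊆ checkNbhd G K ∪ (D ∩ checkNbhd G K) :=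
      Finset.inter_subset_right.trans Finset.subset_union_left
    have hc : (((syndromeX G E ∆ D) ∩ checkNbhd G K).card : ℝ) ≤
        dB * K.card + (D ∩ checkNbhd G K).card := by
      exact_mod_cast (Finset.card_le_card hsub).trans ((Finset.card_union_le _ _).trans
        (Nat.add_le_add_right (card_checkNbhd_le hG hAB K) _))
    have := mul_le_mul_of_nonneg_left hc hk0.le
    rw [hEK]
    linarith
  | @tail s s' _ hstep ih =>
    obtain ⟨hσ, U, hEU, hRU, hU⟩ := ih
    obtain ⟨F, ⟨⟨hFne, ⟨g, hFg⟩, hFc⟩, hdec⟩, rfl⟩ := hstep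
    have hER : E ∆ (s.1 ∆ F) = (E ∆ s.1) ∆ F := (symmDiff_assoc _ _ _).symm
    refine ⟨?_, U ∪ F, hEU.trans Finset.subset_union_left, ?_, fun K hK => ?_⟩
    · simp only [hER]
      rw [syndromeX_symmDiff, hσ, symmDiff_right_comm]
    · simp only [hER]
      exact (Finset.symmDiff_subset_union).trans (Finset.union_subset_union_left hRU)
    have hK' := hK.inter_left (Finset.subset_union_left (s₂ := F))
    have hind := hU _ hK'
    have hEK : E ∩ (K ∩ U) = E ∩ K := by
      ext x
      have := @hEU x
      simp only [Finset.mem_inter]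
      tauto
    rw [hEK] at hind
    rcases hK.subset_or_disjoint hFg Finset.subset_union_right with hFK | hFK
    · have hcard : (K.card : ℝ) ≤ (K ∩ U).card + F.card := by
        have : K ⊆ (K ∩ U) ∪ F := fun x hx => by
          have := hK.1 hx
          simp only [Finset.mem_union, Finset.mem_inter] at this ⊢
          tauto
        exact_mod_cast (Finset.card_le_card this).trans (Finset.card_union_le _ _)
      set N := checkNbhd G K with hN
      set N' := checkNbhd G (K ∩ U) with hN'
      have hNN : N' ⊆ N := checkNbhd_mono Finset.inter_subset_left
      -- Before the flip, the residual error inside `K` lies in `K ∩ U`. On checks reached only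
      -- through `F` the syndrome therefore consists of elements of `D`, already counted on the
      -- right-hand side.
      have hσsub : s.2 ∩ N ⊆ (s.2 ∩ N') ∪ (D ∩ (N \ N')) := by
        intro c hc
        have key : c ∈ N → c ∉ N' → c ∉ syndromeX G (E ∆ s.1) := by
          intro h1 h2 h3
          rw [hK.mem_syndromeX_iff (hRU.trans Finset.subset_union_left) h1] at h3
          refine h2 (checkNbhd_mono ?_ (syndromeX_subset_checkNbhd _ h3))
          rw [Finset.inter_comm]
          exact Finset.inter_subset_inter_left hRU
        rw [hσ] at hc ⊢
        simp only [Finset.mem_union, Finset.mem_inter, Finset.mem_sdiff, Finset.mem_symmDiff]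
          at hc ⊢
        tauto
      have h1 : ((s.2 ∩ N).card : ℝ) ≤ (s.2 ∩ N').card + (D ∩ (N \ N')).card := by
        exact_mod_cast (Finset.card_le_card hσsub).trans (Finset.card_union_le _ _)
      have h2 : ((D ∩ N').card : ℝ) + (D ∩ (N \ N')).card = (D ∩ N).card := by
        have hdj : Disjoint (D ∩ N') (D ∩ (N \ N')) :=
          Finset.disjoint_of_subset_left Finset.inter_subset_right
            (Finset.disjoint_of_subset_right Finset.inter_subset_right Finset.disjoint_sdiff)
        rw [← Nat.cast_add, ← Finset.card_union_of_disjoint hdj, ← Finset.inter_union_distrib_left,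
          Finset.union_sdiff_of_subset hNN]
      have h3 : ((s.2 ∆ syndromeX G F ∩ N).card : ℝ) =
          (s.2 ∩ N).card - (syndromeDecrease G s.2 F : ℝ) := by
        have e1 := Finset.card_sdiff_add_card_inter s.2 N
        have e2 := Finset.card_sdiff_add_card_inter (s.2 ∆ syndromeX G F) N
        have e3 : (s.2 ∆ syndromeX G F) \ N = s.2 \ N := by
          ext c
          have h5 : c ∈ syndromeX G F → c ∈ N := fun h =>
            checkNbhd_mono hFK (syndromeX_subset_checkNbhd _ h)
          simp only [Finset.mem_sdiff, Finset.mem_symmDiff]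
          tauto
        rw [e3] at e2
        have e1' : ((s.2 \ N).card : ℝ) + (s.2 ∩ N).card = s.2.card := by exact_mod_cast e1
        have e2' : ((s.2 \ N).card : ℝ) + (s.2 ∆ syndromeX G F ∩ N).card =
          (s.2 ∆ syndromeX G F).card := by exact_mod_cast e2
        rw [syndromeDecrease]
        push_cast
        linarith
      have h4 : (F.card : ℝ) ≤ k * (syndromeDecrease G s.2 F : ℝ) := by
        have h5 : β * (dA / 2 * F.card) ≤ (syndromeDecrease G s.2 F : ℝ) :=
          (mul_le_mul_of_nonneg_left hFc hβ.le).trans hdec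
        have h6 := mul_le_mul_of_nonneg_left h5 hk0.le
        have h7 : k * (β * (dA / 2 * F.card)) = F.card := by
          rw [hk]; field_simp
        linarith
      simp only [h3]
      have h8 := mul_le_mul_of_nonneg_left h1 hk0.le
      rw [← h2]
      linarith
    · have hKU : K ∩ U = K := by
        refine Finset.inter_eq_left.2 fun x hx => ?_
        rcases Finset.mem_union.1 (hK.1 hx) with h | h
        · exact h
        · exact absurd hx (Finset.disjoint_left.1 hFK h)
      rw [hKU] at hind
      have hσK : s.2 ∆ syndromeX G F ∩ checkNbhd G K = s.2 ∩ checkNbhd G K := by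
        ext c
        have h5 : c ∈ checkNbhd G K → c ∉ syndromeX G F := by
          intro h6 h7
          rw [hK.mem_syndromeX_iff Finset.subset_union_right h6,
            Finset.disjoint_iff_inter_eq_empty.1 hFK, syndromeX_empty] at h7
          simp at h7
        simp only [Finset.mem_inter, Finset.mem_symmDiff]
        tauto
      simp only [hσK]
      exact hind

/-- Induction on the weight. A generator violating reducedness carries more than half of its weight
in `R`, so adding it lowers the weight by at least one. The factor `dA + dB` in the potential then
pays for the at most `dA + dB` qubits joining the region. -/
theorem exists_reducedError {dA dB : ℕ} (hG : IsBiregular G dA dB)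
    {E : Finset (Qubit A B)} {D : Finset (A × B)} {C : ℝ} (m : ℕ) :
    ∀ R U : Finset (Qubit A B), qubitWeight dA dB R = m → E ⊆ U → R ⊆ U →
    (∀ K, IsSeparated (QubitAdj G) U K →
      (K.card : ℝ) + (dA + dB) * qubitWeight dA dB (R ∩ K) ≤
        C * ((E ∩ K).card + (D ∩ checkNbhd G K).card)) → 0 ≤ C →
    ∃ R' U' : Finset (Qubit A B), EquivErrors G R' R ∧ IsReducedError G dA dB R' ∧ R' ⊆ U' ∧
      syndromeX G R' = syndromeX G R ∧
      ∀ K, IsSeparated (QubitAdj G) U' K →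
        (K.card : ℝ) ≤ C * ((E ∩ K).card + (D ∩ checkNbhd G K).card) := by
  induction m using Nat.strong_induction_on with
  | _ m ih =>
  intro R U hm hEU hRU hK hC
  by_cases hred : IsReducedError G dA dB R
  · refine ⟨R, U, ⟨∅, by simp [xorSum_empty]⟩, hred, hRU, rfl, fun K hKU => ?_⟩
    have := hK K hKU
    have h0 : (0 : ℝ) ≤ (dA + dB) * qubitWeight dA dB (R ∩ K) := by positivity
    linarith
  simp only [IsReducedError, not_forall, not_le] at hred
  obtain ⟨g, hg⟩ := hred
  have hwg := qubitWeight_gammaZ hG g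
  have hwR := qubitWeight_symmDiff_add (dA := dA) (dB := dB) R (gammaZ G g)
  refine Exists.elim (ih (qubitWeight dA dB (R ∆ gammaZ G g)) (by omega)
    (R ∆ gammaZ G g) (U ∪ gammaZ G g) rfl (hEU.trans Finset.subset_union_left)
    (Finset.symmDiff_subset_union.trans (Finset.union_subset_union_left hRU)) ?_ hC) ?_
  swap
  · rintro R' ⟨U', ⟨X, hX⟩, h1, h2, h3, h4⟩
    refine ⟨R', U', ⟨X ∆ {g}, ?_⟩, h1, h2, ?_, h4⟩
    · rw [xorSum_symmDiff, ← hX, xorSum_singleton, symmDiff_assoc, symmDiff_symmDiff_cancel_right]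
    · rw [h3, syndromeX_symmDiff, syndromeX_gammaZ]
      simp
  intro K hKU
  have hK' := hKU.inter_left (Finset.subset_union_left (s₂ := gammaZ G g))
  have hind := hK _ hK'
  have hmono : C * ((E ∩ (K ∩ U)).card + (D ∩ checkNbhd G (K ∩ U)).card) ≤
      C * ((E ∩ K).card + (D ∩ checkNbhd G K).card) := by
    have e1 : (E ∩ (K ∩ U)).card ≤ (E ∩ K).card :=
      Finset.card_le_card (Finset.inter_subset_inter_left Finset.inter_subset_left)
    have e2 : (D ∩ checkNbhd G (K ∩ U)).card ≤ (D ∩ checkNbhd G K).card :=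
      Finset.card_le_card (Finset.inter_subset_inter_left (checkNbhd_mono Finset.inter_subset_left))
    gcongr
  refine le_trans ?_ (hind.trans hmono)
  have hRK : R ∩ (K ∩ U) = R ∩ K := by
    ext x
    have := @hRU x
    simp only [Finset.mem_inter]
    tauto
  rw [hRK]
  rcases hKU.subset_or_disjoint subset_rfl Finset.subset_union_right with hgK | hgK
  · have hcard : (K.card : ℝ) ≤ (K ∩ U).card + (dA + dB) := by
      have : K ⊆ (K ∩ U) ∪ gammaZ G g := fun x hx => by
        have := hKU.1 hx
        simp only [Finset.mem_union, Finset.mem_inter] at this ⊢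
        tauto
      have := (Finset.card_le_card this).trans (Finset.card_union_le _ _)
      rw [card_gammaZ hG] at this
      exact_mod_cast this
    have hw : (qubitWeight dA dB (R ∆ gammaZ G g ∩ K) : ℝ) + 1 ≤ qubitWeight dA dB (R ∩ K) := by
      have e1 : R ∆ gammaZ G g ∩ K = (R ∩ K) ∆ gammaZ G g := by
        ext x
        have := @hgK x
        simp only [Finset.mem_inter, Finset.mem_symmDiff]
        tauto
      have e2 : R ∩ K ∩ gammaZ G g = R ∩ gammaZ G g := by
        ext x
        have := @hgK x
        simp only [Finset.mem_inter]
        tauto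
      have e3 := qubitWeight_symmDiff_add (dA := dA) (dB := dB) (R ∩ K) (gammaZ G g)
      rw [e2] at e3
      rw [e1]
      norm_cast
      omega
    have hpos : (0 : ℝ) ≤ dA + dB := by positivity
    have := mul_le_mul_of_nonneg_left hw hpos
    linarith
  · have hKU' : K ∩ U = K := by
      refine Finset.inter_eq_left.2 fun x hx => ?_
      rcases Finset.mem_union.1 (hKU.1 hx) with h | h
      · exact h
      · exact absurd hx (Finset.disjoint_left.1 hgK h)
    have e1 : R ∆ gammaZ G g ∩ K = R ∩ K := by
      ext x
      have : x ∈ gammaZ G g → x ∉ K := fun h => Finset.disjoint_left.1 hgK h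
      simp only [Finset.mem_inter, Finset.mem_symmDiff]
      tauto
    rw [hKU', e1]

/-- The constant `C` such that every component of the region touched by the decoder contains at
most `C` qubits per error in the component. -/
noncomputable def regionConst (dA dB : ℕ) (β : ℝ) : ℝ :=
  (1 + (dA + dB) * dB) * (1 + 2 / (β * dA) * dB)

/-- The set `K` contains so many errors that it may be a component of the region touched by the
decoder. -/
def IsHeavy (G : A → B → Prop) [DecidableRel G] (C : ℝ) (E : Finset (Qubit A B))
    (D : Finset (A × B)) (K : Finset (Qubit A B)) : Prop :=
  (K.card : ℝ) ≤ C * ((E ∩ K).card + (D ∩ checkNbhd G K).card)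

/-- If there is no large connected set with many errors, then the output of the decoder leaves a
residual error equivalent to one whose components are paid for by the syndrome errors. -/
theorem exists_residual {dA dB : ℕ} (hdA : 0 < dA) (hAB : dA ≤ dB) {γ δ t β : ℝ}
    (hδ : 0 ≤ δ) (hβ : 0 < β) (hβ' : β < betaOne δ) (hG : IsBiregular G dA dB)
    (hE : IsExpanding G dA dB γ δ)
    (htA : t ≤ γ * Fintype.card A) (htB : t ≤ γ * Fintype.card B)
    {E Ehat : Finset (Qubit A B)} {D : Finset (A × B)}
    (hout : IsDecoderOutput G dA β (syndromeX G E ∆ D) Ehat) :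
    ∃ R, EquivErrors G R (E ∆ Ehat) ∧
      ((∀ v K, Rooted (QubitAdj G) {v} K → IsHeavy G (regionConst dA dB β) E D K →
          (K.card : ℝ) ≤ t) →
        ∀ S ⊆ R, ∃ W, Rooted (QubitAdj G) S W ∧
          (W.card : ℝ) ≤ cZero dA δ β * (D ∩ checkNbhd G W).card) := by
  obtain ⟨σf, hrun, hterm⟩ := hout
  obtain ⟨hσ, U, hEU, hRU, hU⟩ := DecoderStep.exists_region hdA hAB hβ hG hrun
  simp only at hσ hRU hU
  have hd : (0 : ℝ) < dA := by exact_mod_cast hdA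
  have hdB : (1 : ℝ) ≤ dB := by exact_mod_cast hdA.trans_le hAB
  set k : ℝ := 2 / (β * dA) with hk
  have hk0 : 0 < k := by positivity
  have hC0 : 0 ≤ regionConst dA dB β := by unfold regionConst; positivity
  refine Exists.elim (exists_reducedError hG
    (C := regionConst dA dB β) (D := D) _ (E ∆ Ehat) U rfl hEU hRU ?_ hC0) ?_
  swap
  · rintro R ⟨U', hequiv, hred, hRU', hsyn, hU'⟩
    refine ⟨R, hequiv, fun hsucc S hS => ?_⟩
    have hsmall : HasSmallComponents G t R := by
      intro x hx
      obtain ⟨K, hxK, hK⟩ := exists_rooted_isSeparated (QubitAdj G)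
        (Finset.singleton_subset_iff.2 (hRU' hx))
      exact ⟨K, Finset.singleton_subset_iff.1 hxK.1, hsucc x K hxK (hU' K hK),
        fun y hy z hz => hK.2 y hy z (hRU' hz)⟩
    obtain ⟨W, hSW, hW⟩ := exists_rooted_isSeparated (QubitAdj G) hS
    refine ⟨W, hSW, card_le_of_not_canFlip hdA hAB hδ hβ' hG hE htA htB hred hsmall ?_ hW⟩
    rw [hsyn, ← hσ]
    exact hterm
  -- The initial potential: the weight of the residual error in `K` is at most `dB|K|`, whence the
  -- first factor of `regionConst`. Dropping the syndrome term from the region bound gives the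
  -- second.
  · intro K hK
    have h1 := hU K hK
    have h2 : (qubitWeight dA dB ((E ∆ Ehat) ∩ K) : ℝ) ≤ dB * K.card := by
      exact_mod_cast (qubitWeight_mono Finset.inter_subset_right).trans (qubitWeight_le hAB K)
    have h3 : (K.card : ℝ) ≤ (1 + k * dB) * ((E ∩ K).card + (D ∩ checkNbhd G K).card) := by
      have e1 : 0 ≤ k * (σf ∩ checkNbhd G K).card := by positivity
      have e2 : k * (D ∩ checkNbhd G K).card ≤ (1 + k * dB) * (D ∩ checkNbhd G K).card := by
        gcongr
        nlinarith
      linarith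
    have h4 : (dA + dB : ℝ) * qubitWeight dA dB ((E ∆ Ehat) ∩ K) ≤ (dA + dB) * (dB * K.card) := by
      gcongr
    have h5 := mul_le_mul_of_nonneg_left h3 (show (0 : ℝ) ≤ 1 + (dA + dB) * dB by positivity)
    rw [regionConst]
    linarith

end Locality

/-! ### Measurability and union bounds -/

section Probability

open MeasureTheory

variable {Ω V C : Type*} [MeasurableSpace Ω]

theorem measurableSet_of_isRandomSet [Fintype V] [Fintype C] {X Y : Ω → Finset V}
    {Z : Ω → Finset C} (hX : IsRandomSet X) (hY : IsRandomSet Y) (hZ : IsRandomSet Z)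
    (P : Finset V → Finset V → Finset C → Prop) :
    MeasurableSet {ω | P (X ω) (Y ω) (Z ω)} := by
  have h : {ω | P (X ω) (Y ω) (Z ω)} =
      ⋃ x, ⋃ y, ⋃ z, ⋃ (_ : P x y z), {ω | X ω = x} ∩ {ω | Y ω = y} ∩ {ω | Z ω = z} := by
    ext ω
    simp only [Set.mem_ofPred_eq, Set.mem_iUnion, Set.mem_inter_iff]
    constructor
    · exact fun h => ⟨_, _, _, h, ⟨rfl, rfl⟩, rfl⟩
    · rintro ⟨x, y, z, h, ⟨rfl, rfl⟩, rfl⟩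
      exact h
  rw [h]
  exact MeasurableSet.iUnion fun x => MeasurableSet.iUnion fun y => MeasurableSet.iUnion fun z =>
    MeasurableSet.iUnion fun _ => ((hX x).inter (hY y)).inter (hZ z)

/-- Union bound over the possible values of `(E ∩ K, D ∩ L)`; since `r ≤ 1`, each admissible pair
has probability at most `r ^ x`. -/
theorem measureReal_le_card_inter_le [DecidableEq V] [DecidableEq C] (μ : Measure Ω)
    [IsProbabilityMeasure μ] (E : Ω → Finset V) (D : Ω → Finset C) (K : Finset V) (L : Finset C)
    {r x : ℝ} (hr : 0 ≤ r) (hr1 : r ≤ 1) (hx : 0 ≤ x)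
    (h : ∀ S ⊆ K, ∀ T ⊆ L, μ.real {ω | S ⊆ E ω ∧ T ⊆ D ω} ≤ r ^ (S.card + T.card)) :
    μ.real {ω | x ≤ (E ω ∩ K).card + (D ω ∩ L).card} ≤ 2 ^ (K.card + L.card) * r ^ x := by
  let 𝒯 := (K.powerset ×ˢ L.powerset).filter (fun p => x ≤ (p.1.card + p.2.card : ℝ))
  have hsub : {ω | x ≤ (E ω ∩ K).card + (D ω ∩ L).card} ⊆
      ⋃ p ∈ 𝒯, {ω | p.1 ⊆ E ω ∧ p.2 ⊆ D ω} := by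
    intro ω hω
    simp only [Set.mem_iUnion]
    refine ⟨(E ω ∩ K, D ω ∩ L), ?_, Finset.inter_subset_left, Finset.inter_subset_left⟩
    exact Finset.mem_filter.2 ⟨Finset.mem_product.2
      ⟨Finset.mem_powerset.2 Finset.inter_subset_right,
        Finset.mem_powerset.2 Finset.inter_subset_right⟩, hω⟩
  calc _ ≤ ∑ p ∈ 𝒯, μ.real {ω | p.1 ⊆ E ω ∧ p.2 ⊆ D ω} :=
        (measureReal_mono hsub (measure_ne_top μ _)).trans (measureReal_biUnion_finset_le _ _)
    _ ≤ ∑ _p ∈ 𝒯, r ^ x := by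
        refine Finset.sum_le_sum fun p hp => ?_
        obtain ⟨h1, h2⟩ := Finset.mem_filter.1 hp
        obtain ⟨h3, h4⟩ := Finset.mem_product.1 h1
        refine (h _ (Finset.mem_powerset.1 h3) _ (Finset.mem_powerset.1 h4)).trans ?_
        rw [← Real.rpow_natCast]
        refine Real.rpow_le_rpow_of_exponent_ge' hr hr1 hx ?_
        push_cast
        exact h2
    _ ≤ 2 ^ (K.card + L.card) * r ^ x := by
        rw [Finset.sum_const, nsmul_eq_mul]
        have : 𝒯.card ≤ 2 ^ (K.card + L.card) := by
          refine (Finset.card_filter_le _ _).trans ?_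
          rw [Finset.card_product, Finset.card_powerset, Finset.card_powerset, pow_add]
        have hrx : 0 ≤ r ^ x := Real.rpow_nonneg hr x
        gcongr
        exact_mod_cast this

theorem cond_real_le (μ : Measure Ω) [IsProbabilityMeasure μ] {s : Set Ω}
    (hs : MeasurableSet s) (h : 1 / 2 ≤ μ.real s) (t : Set Ω) :
    (ProbabilityTheory.cond μ s).real t ≤ 2 * μ.real (s ∩ t) := by
  rw [Measure.real, ProbabilityTheory.cond_apply hs, ENNReal.toReal_mul, ENNReal.toReal_inv]
  refine mul_le_mul_of_nonneg_right ?_ measureReal_nonneg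
  exact (inv_anti₀ (by norm_num) h).trans (by norm_num)

end Probability

/-! ### Percolation estimates for the code -/

section CodeProbability

open MeasureTheory

variable {A B : Type*} [Fintype A] [Fintype B] [DecidableEq A] [DecidableEq B]
variable {G : A → B → Prop} [DecidableRel G] {Ω : Type*} [MeasurableSpace Ω]

theorem card_mul_eq_card_mul {dA dB : ℕ} (hG : IsBiregular G dA dB) :
    Fintype.card A * dA = Fintype.card B * dB := by
  have h := Finset.sum_card_bipartiteAbove_eq_sum_card_bipartiteBelow G
    (s := (Finset.univ : Finset A)) (t := (Finset.univ : Finset B))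
  have h1 : ∀ a, (Finset.bipartiteAbove G Finset.univ a).card = dA := hG.1
  have h2 : ∀ b, (Finset.bipartiteBelow G Finset.univ b).card = dB := hG.2
  simpa [h1, h2] using h

theorem card_right_le {dA dB : ℕ} (hdA : 0 < dA) (hAB : dA ≤ dB) (hG : IsBiregular G dA dB) :
    Fintype.card B ≤ Fintype.card A := by
  refine Nat.le_of_mul_le_mul_right ?_ hdA
  rw [card_mul_eq_card_mul hG]
  exact Nat.mul_le_mul_left _ hAB

/-- Here `√(|A|² + |B|²) ≤ |A| + |B|` and `dA|A| = dB|B|`. This turns a size threshold proportional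
to `|B|` into one of order `√n`. -/
theorem sqrt_card_qubit_le {dA dB : ℕ} (hG : IsBiregular G dA dB) :
    dA * Real.sqrt (Fintype.card (Qubit A B)) ≤ (dA + dB) * Fintype.card B := by
  have h1 : Real.sqrt (Fintype.card (Qubit A B)) ≤ Fintype.card A + Fintype.card B := by
    refine Real.sqrt_le_iff.2 ⟨by positivity, ?_⟩
    simp only [Fintype.card_sum, Fintype.card_prod]
    norm_cast
    nlinarith [Nat.zero_le (Fintype.card A * Fintype.card B)]
  have h2 : (Fintype.card A * dA : ℝ) = Fintype.card B * dB := by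
    exact_mod_cast card_mul_eq_card_mul hG
  have h3 := mul_le_mul_of_nonneg_left h1 (Nat.cast_nonneg (α := ℝ) dA)
  linarith

/-- Since `n ≤ e^(2√n)`, two of the three `√n` absorb the union bound over the starting qubit. -/
theorem mul_exp_neg_le (n : ℕ) {x : ℝ} (hx : 3 * Real.sqrt n ≤ x) :
    n * Real.exp (-x) ≤ Real.exp (-1 * Real.sqrt n) := by
  have h1 : Real.sqrt n ≤ Real.exp (Real.sqrt n) := by
    linarith [Real.add_one_le_exp (Real.sqrt n)]
  have h2 : (n : ℝ) ≤ Real.exp (Real.sqrt n) * Real.exp (Real.sqrt n) := by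
    calc (n : ℝ) = Real.sqrt n * Real.sqrt n := (Real.mul_self_sqrt (Nat.cast_nonneg n)).symm
      _ ≤ _ := mul_self_le_mul_self (Real.sqrt_nonneg _) h1
  calc n * Real.exp (-x) ≤ (Real.exp (Real.sqrt n) * Real.exp (Real.sqrt n)) * Real.exp (-x) := by
        gcongr
    _ = Real.exp (Real.sqrt n + Real.sqrt n - x) := by
        rw [← Real.exp_add, ← Real.exp_add]; ring_nf
    _ ≤ _ := Real.exp_le_exp.2 (by linarith)

/-- With high probability no large connected set of qubits is heavy. -/
theorem measureReal_exists_heavy_le {dA dB : ℕ} (hAB : dA ≤ dB) (hG : IsBiregular G dA dB)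
    (μ : Measure Ω) [IsProbabilityMeasure μ] {E : Ω → Finset (Qubit A B)}
    {D : Ω → Finset (A × B)} {r c m t : ℝ} (hr : 0 ≤ r) (hr1 : r ≤ 1) (hc : 0 < c) (hm : 0 ≤ m)
    (hrm : 2 ^ (2 * (dB * (dA + dB))) * (2 ^ (1 + dB) * r ^ (1 / c) * Real.exp m) ≤ 1)
    (h : ∀ S T, μ.real {ω | S ⊆ E ω ∧ T ⊆ D ω} ≤ r ^ (S.card + T.card)) :
    μ.real {ω | ¬ ∀ v K, Rooted (QubitAdj G) {v} K → IsHeavy G c (E ω) (D ω) K →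
      (K.card : ℝ) ≤ t} ≤ Fintype.card (Qubit A B) * Real.exp (-(m * t)) := by
  classical
  let ℛ : Qubit A B → Finset (Finset (Qubit A B)) := fun v =>
    Finset.univ.filter (Rooted (QubitAdj G) {v})
  let 𝒮 : Qubit A B → Finset (Finset (Qubit A B)) := fun v =>
    (ℛ v).filter (fun K => t < (K.card : ℝ))
  set q : ℝ := 2 ^ (1 + dB) * r ^ (1 / c) * Real.exp m with hq
  have hr0 : 0 ≤ r ^ (1 / c) := Real.rpow_nonneg hr _
  have hq0 : 0 ≤ q := by positivity
  have hsub : {ω | ¬ ∀ v K, Rooted (QubitAdj G) {v} K → IsHeavy G c (E ω) (D ω) K →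
      (K.card : ℝ) ≤ t} ⊆ ⋃ v ∈ (Finset.univ : Finset (Qubit A B)), ⋃ K ∈ 𝒮 v,
        {ω | IsHeavy G c (E ω) (D ω) K} := by
    intro ω hω
    simp only [Set.mem_ofPred_eq, not_forall, not_le] at hω
    obtain ⟨v, K, h1, h2, h3⟩ := hω
    simp only [Set.mem_iUnion]
    exact ⟨v, Finset.mem_univ v, K, Finset.mem_filter.2
      ⟨Finset.mem_filter.2 ⟨Finset.mem_univ K, h1⟩, h3⟩, h2⟩
  have hK : ∀ K : Finset (Qubit A B), t < K.card →
      μ.real {ω | IsHeavy G c (E ω) (D ω) K} ≤ Real.exp (-(m * t)) * q ^ K.card := by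
    intro K hKt
    have h1 : {ω | IsHeavy G c (E ω) (D ω) K} = {ω | (K.card : ℝ) / c ≤
        (E ω ∩ K).card + (D ω ∩ checkNbhd G K).card} := by
      ext ω
      exact (div_le_iff₀' hc).symm
    have h2 : r ^ ((K.card : ℝ) / c) = (r ^ (1 / c)) ^ K.card := by
      rw [← Real.rpow_natCast, ← Real.rpow_mul hr]
      ring_nf
    have h3 : (2 : ℝ) ^ (K.card + (checkNbhd G K).card) ≤ (2 ^ (1 + dB)) ^ K.card := by
      rw [← pow_mul]
      refine pow_le_pow_right₀ (by norm_num) ?_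
      have := card_checkNbhd_le hG hAB K
      linarith
    -- Exponential tilting: `|K| > t` yields the decay `e^(-mt)` at the price of a factor `e^m` per
    -- qubit, absorbed in `q`.
    have h4 : (1 : ℝ) ≤ Real.exp (-(m * t)) * Real.exp m ^ K.card := by
      rw [← Real.exp_nat_mul, ← Real.exp_add]
      refine Real.one_le_exp ?_
      have := mul_le_mul_of_nonneg_left hKt.le hm
      linarith
    rw [h1]
    refine (measureReal_le_card_inter_le μ E D K _ hr hr1 (by positivity)
      fun S _ T _ => h S T).trans ?_
    rw [h2]
    calc _ ≤ (2 ^ (1 + dB)) ^ K.card * (r ^ (1 / c)) ^ K.card * 1 := by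
          rw [mul_one]; gcongr
      _ ≤ (2 ^ (1 + dB)) ^ K.card * (r ^ (1 / c)) ^ K.card *
          (Real.exp (-(m * t)) * Real.exp m ^ K.card) := by gcongr
      _ = _ := by rw [hq, mul_pow, mul_pow]; ring
  have hv : ∀ v, ∑ K ∈ 𝒮 v, μ.real {ω | IsHeavy G c (E ω) (D ω) K} ≤ Real.exp (-(m * t)) := by
    intro v
    have hroot : ∑ K ∈ ℛ v, q ^ K.card ≤ 1 := by
      refine (sum_rooted_pow_le (card_qubitAdj_le hG hAB) {v} hq0 hrm).trans ?_
      exact pow_le_one₀ (by positivity) hrm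
    calc _ ≤ ∑ K ∈ 𝒮 v, Real.exp (-(m * t)) * q ^ K.card :=
          Finset.sum_le_sum fun K hK' => hK K (Finset.mem_filter.1 hK').2
      _ ≤ ∑ K ∈ ℛ v, Real.exp (-(m * t)) * q ^ K.card :=
          Finset.sum_le_sum_of_subset_of_nonneg (Finset.filter_subset _ _)
            fun _ _ _ => by positivity
      _ ≤ Real.exp (-(m * t)) * 1 := by
          rw [← Finset.mul_sum]
          gcongr
      _ = _ := mul_one _
  calc _ ≤ ∑ v, μ.real (⋃ K ∈ 𝒮 v, {ω | IsHeavy G c (E ω) (D ω) K}) :=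
        (measureReal_mono hsub (measure_ne_top μ _)).trans (measureReal_biUnion_finset_le _ _)
    _ ≤ ∑ _v : Qubit A B, Real.exp (-(m * t)) :=
        Finset.sum_le_sum fun v _ => (measureReal_biUnion_finset_le _ _).trans (hv v)
    _ = _ := by rw [Finset.sum_const, nsmul_eq_mul, Finset.card_univ]

/-- The probability that the syndrome errors pay for a set of qubits containing `S`. -/
theorem measureReal_exists_paid_le {dA dB : ℕ} (hAB : dA ≤ dB) (hG : IsBiregular G dA dB)
    (μ : Measure Ω) [IsProbabilityMeasure μ] {D : Ω → Finset (A × B)} {r c : ℝ} (hr : 0 ≤ r)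
    (hr1 : r ≤ 1) (hc : 0 < c)
    (hrc : 2 ^ (2 * (dB * (dA + dB))) * (2 ^ dB * r ^ (1 / c)) ≤ 1)
    (h : ∀ T, μ.real {ω | T ⊆ D ω} ≤ r ^ T.card) (S : Finset (Qubit A B)) :
    μ.real {ω | ∃ W, Rooted (QubitAdj G) S W ∧
      (W.card : ℝ) ≤ c * (D ω ∩ checkNbhd G W).card} ≤
        (2 ^ (2 * (dB * (dA + dB))) * (2 ^ dB * r ^ (1 / c))) ^ S.card := by
  classical
  have hr0 : 0 ≤ r ^ (1 / c) := Real.rpow_nonneg hr _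
  refine le_trans ?_ (sum_rooted_pow_le (card_qubitAdj_le hG hAB) S (by positivity) hrc)
  have hsub : {ω | ∃ W, Rooted (QubitAdj G) S W ∧ (W.card : ℝ) ≤ c * (D ω ∩ checkNbhd G W).card} ⊆
      ⋃ W ∈ Finset.univ.filter (Rooted (QubitAdj G) S),
        {ω | (W.card : ℝ) ≤ c * (D ω ∩ checkNbhd G W).card} := by
    rintro ω ⟨W, h1, h2⟩
    simp only [Set.mem_iUnion]
    exact ⟨W, Finset.mem_filter.2 ⟨Finset.mem_univ W, h1⟩, h2⟩
  refine (measureReal_mono hsub (measure_ne_top μ _)).trans ((measureReal_biUnion_finset_le _ _).trans ?_)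
  refine Finset.sum_le_sum fun W _ => ?_
  -- An empty qubit error reduces the event to the two-error bound, with only subsets of the check
  -- neighbourhood to count.
  have h1 : {ω | (W.card : ℝ) ≤ c * (D ω ∩ checkNbhd G W).card} =
      {ω | (W.card : ℝ) / c ≤ ((fun _ => ∅ : Ω → Finset (Qubit A B)) ω ∩ ∅).card +
        (D ω ∩ checkNbhd G W).card} := by
    ext ω
    simp [div_le_iff₀' hc]
  have h2 : r ^ ((W.card : ℝ) / c) = (r ^ (1 / c)) ^ W.card := by
    rw [← Real.rpow_natCast, ← Real.rpow_mul hr]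
    ring_nf
  rw [h1]
  refine (measureReal_le_card_inter_le μ _ D ∅ _ hr hr1 (by positivity) ?_).trans ?_
  · intro S hS T _
    obtain rfl := Finset.subset_empty.1 hS
    simpa using h T
  · rw [h2, mul_pow, ← pow_mul, Finset.card_empty, zero_add]
    gcongr
    · norm_num
    · exact card_checkNbhd_le hG hAB W

end CodeProbability

/-! ### Choice of the constants and conclusion -/

theorem mainTheorem2 (dA dB : ℕ) (hdA : 0 < dA) (hdAB : dA ≤ dB)
    (γ δ β : ℝ) (hγ : 0 < γ) (hδ : 0 < δ) (hδ' : δ < 1 / 16) (hβ : 0 < β) (hβ' : β < betaOne δ) :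
    ∃ p₀ > (0 : ℝ), ∃ p₁ > (0 : ℝ), ∃ K > (0 : ℝ), ∃ κ > (0 : ℝ),
      ∀ (A B : Type*) [Fintype A] [Fintype B] [DecidableEq A] [DecidableEq B]
        (G : A → B → Prop) [DecidableRel G],
        IsBiregular G dA dB → IsExpanding G dA dB γ δ →
      ∀ (Ω : Type*) [MeasurableSpace Ω] (μ : MeasureTheory.Measure Ω)
        [MeasureTheory.IsProbabilityMeasure μ]
        (E Ehat : Ω → Finset (Qubit A B)) (D : Ω → Finset (A × B)) (pphys psynd : ℝ),
        IsRandomSet E → IsRandomSet D → IsRandomSet Ehat →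
        (∀ ω, IsDecoderOutput G dA β (syndromeX G (E ω) ∆ D ω) (Ehat ω)) →
        0 ≤ pphys → pphys < p₀ → 0 ≤ psynd → psynd < p₁ →
        IsLocalStochasticPair μ E D pphys psynd →
        ∃ succ : Set Ω, MeasurableSet succ ∧
          1 - Real.exp (-κ * Real.sqrt (Fintype.card (Qubit A B))) ≤ μ.real succ ∧
          ∃ Els : Ω → Finset (Qubit A B), IsRandomSet Els ∧
            (∀ ω, EquivErrors G (Els ω) (E ω ∆ Ehat ω)) ∧
            IsLocalStochastic (ProbabilityTheory.cond μ succ) Els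
              (K * psynd ^ (1 / cZero dA δ β)) := by
  have hd : (0 : ℝ) < dA := by exact_mod_cast hdA
  have hb : 0 < betaOne δ - β := sub_pos.2 hβ'
  have hc : 0 < regionConst dA dB β := by unfold regionConst; positivity
  have hc₀ : 0 < cZero dA δ β := by unfold cZero; positivity
  set c := regionConst dA dB β
  set c₀ := cZero dA δ β
  -- The rate is chosen so that `m * (γ |B|) ≥ 3√n`.
  set m : ℝ := 3 * (dA + dB) / (γ * dA) with hm
  have hm0 : 0 < m := by positivity
  set Z : ℝ := 2 ^ (2 * (dB * (dA + dB))) with hZ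
  have hZ1 : 1 ≤ Z := one_le_pow₀ (by norm_num)
  have hZ0 : 0 < Z := by linarith
  -- `x` and, below, `y` are the largest values of `r ^ (1/c)` and `r ^ (1/c₀)` for which the sums
  -- over rooted sets converge; the noise thresholds are `x ^ c` and `y ^ c₀`.
  set x : ℝ := (Z * 2 ^ (1 + dB) * Real.exp m)⁻¹ with hx
  have hx0 : 0 < x := by positivity
  have hx1 : x ≤ 1 := by
    refine inv_le_one_of_one_le₀ ?_
    have h1 : (1 : ℝ) ≤ 2 ^ (1 + dB) := one_le_pow₀ (by norm_num)
    have h2 : 1 ≤ Real.exp m := Real.one_le_exp hm0.le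
    exact one_le_mul_of_one_le_of_one_le (one_le_mul_of_one_le_of_one_le hZ1 h1) h2
  set y : ℝ := (Z * 2 ^ dB)⁻¹ with hy
  have hy0 : 0 < y := by positivity
  have hpow : ∀ {u v : ℝ}, 0 < u → 0 < v → (u ^ v) ^ (1 / v) = u := fun {u v} hu hv => by
    rw [← Real.rpow_mul hu.le, mul_one_div_cancel hv.ne', Real.rpow_one]
  refine ⟨x ^ c, Real.rpow_pos_of_pos hx0 _, min (x ^ c) (y ^ c₀),
    lt_min (Real.rpow_pos_of_pos hx0 _) (Real.rpow_pos_of_pos hy0 _), 2 * (Z * 2 ^ dB),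
    by positivity, 1, one_pos, ?_⟩
  intro A B _ _ _ _ G _ hG hexp Ω _ μ _ E Ehat D pphys psynd hE hD hEhat hout hp0 hp hs0 hs hloc
  have hr1 : x ^ c ≤ 1 := Real.rpow_le_one hx0.le hx1 hc.le
  have hr0 : 0 ≤ x ^ c := Real.rpow_nonneg hx0.le _
  have hs1 : psynd ≤ x ^ c := (hs.trans_le (min_le_left _ _)).le
  have hs2 : psynd ≤ y ^ c₀ := (hs.trans_le (min_le_right _ _)).le
  set t : ℝ := γ * Fintype.card B with ht
  have htA : t ≤ γ * Fintype.card A := by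
    rw [ht]
    gcongr
    exact card_right_le hdA hdAB hG
  set P : Finset (Qubit A B) → Finset (A × B) → Prop := fun e d =>
    ∀ v K, Rooted (QubitAdj G) {v} K → IsHeavy G c e d K → (K.card : ℝ) ≤ t with hP
  -- Choosing `R` as a function of the finite data `(e, ehat, d)` makes `E_ls` measurable. The
  -- default `∅` is used only for triples that never occur.
  have hres : ∀ e ehat d, ∃ R, IsDecoderOutput G dA β (syndromeX G e ∆ d) ehat →
      EquivErrors G R (e ∆ ehat) ∧ (P e d → ∀ S ⊆ R, ∃ W, Rooted (QubitAdj G) S W ∧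
        (W.card : ℝ) ≤ c₀ * (d ∩ checkNbhd G W).card) := by
    intro e ehat d
    by_cases h : IsDecoderOutput G dA β (syndromeX G e ∆ d) ehat
    · obtain ⟨R, hR⟩ := exists_residual hdA hdAB hδ.le hβ hβ' hG hexp htA le_rfl h
      exact ⟨R, fun _ => hR⟩
    · exact ⟨∅, fun h' => absurd h' h⟩
  choose f hf using hres
  set succ : Set Ω := {ω | P (E ω) (D ω)} with hsucc
  have hmeas : MeasurableSet succ :=
    measurableSet_of_isRandomSet hE hE hD (fun e _ d => P e d)
  have hprob : 1 - Real.exp (-1 * Real.sqrt (Fintype.card (Qubit A B))) ≤ μ.real succ := by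
    have h1 := measureReal_exists_heavy_le (t := t) hdAB hG μ (E := E) (D := D) hr0 hr1 hc hm0.le
      (by
        rw [hpow hx0 hc]
        refine le_of_eq ?_
        rw [← hZ, hx]
        field_simp) (fun S T => by
        refine (hloc S T).trans ?_
        rw [pow_add]
        gcongr)
    have h2 : m * t = 3 * ((dA + dB) * Fintype.card B / dA) := by
      rw [hm, ht]; field_simp
    have h3 : Real.sqrt (Fintype.card (Qubit A B)) ≤ (dA + dB) * Fintype.card B / dA :=
      (le_div_iff₀' hd).2 (sqrt_card_qubit_le hG)
    have h4 := mul_exp_neg_le (Fintype.card (Qubit A B)) (x := m * t) (by rw [h2]; linarith)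
    have h5 : μ.real succᶜ = 1 - μ.real succ := MeasureTheory.probReal_compl_eq_one_sub hmeas
    have h6 : μ.real succᶜ ≤ Fintype.card (Qubit A B) * Real.exp (-(m * t)) := h1
    linarith
  refine ⟨succ, hmeas, hprob, fun ω => f (E ω) (Ehat ω) (D ω),
    fun S => measurableSet_of_isRandomSet hE hEhat hD (fun e e' d => f e e' d = S),
    fun ω => (hf _ _ _ (hout ω)).1, fun S => ?_⟩
  -- A nonempty `S` forces `n ≥ 1`, hence `ℙ[succ] ≥ 1 - e⁻¹ ≥ 1/2`.
  rcases S.eq_empty_or_nonempty with rfl | hS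
  · simp
  have hhalf : 1 / 2 ≤ μ.real succ := by
    have h1 : 1 ≤ Real.sqrt (Fintype.card (Qubit A B)) := by
      obtain ⟨v, _⟩ := hS
      rw [Real.one_le_sqrt]
      exact_mod_cast Fintype.card_pos_iff.2 ⟨v⟩
    have h2 : Real.exp (-1 * Real.sqrt (Fintype.card (Qubit A B))) ≤ Real.exp (-1) :=
      Real.exp_le_exp.2 (by linarith)
    have h3 : Real.exp (-1) ≤ 1 / 2 := by
      rw [Real.exp_neg, one_div]
      exact inv_anti₀ (by norm_num) (by linarith [Real.add_one_le_exp (1 : ℝ)])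
    linarith
  have hz0 : 0 ≤ psynd ^ (1 / c₀) := Real.rpow_nonneg hs0 _
  have hpaid := measureReal_exists_paid_le hdAB hG μ (D := D) hs0 (hs1.trans hr1) hc₀
    (by
      have h1 : psynd ^ (1 / c₀) ≤ y := by
        rw [← hpow hy0 hc₀]
        exact Real.rpow_le_rpow hs0 hs2 (by positivity)
      calc _ ≤ Z * (2 ^ dB * y) := by gcongr
        _ = 1 := by rw [hy]; field_simp) (fun T => by simpa using hloc ∅ T) S
  calc _ ≤ 2 * μ.real (succ ∩ {ω | S ⊆ f (E ω) (Ehat ω) (D ω)}) := cond_real_le μ hmeas hhalf _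
    _ ≤ 2 * (Z * (2 ^ dB * psynd ^ (1 / c₀))) ^ S.card := by
        gcongr
        refine (MeasureTheory.measureReal_mono ?_).trans hpaid
        rintro ω ⟨h1, h2⟩
        exact (hf _ _ _ (hout ω)).2 h1 S h2
    -- The factor `2` from conditioning is absorbed into the base, since `S` is nonempty.
    _ ≤ 2 ^ S.card * (Z * (2 ^ dB * psynd ^ (1 / c₀))) ^ S.card := by
        gcongr
        exact le_self_pow₀ (by norm_num) hS.card_pos.ne'
    _ = _ := by rw [← mul_pow]; ring_nf
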